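/- Fix $n$ and real numbers $0<\lambda_1<\dots<\lambda_n$. Equip spaces of real, complex or quaternionic square matrices with the Euclidean inner product $\langle x,y\rangle=\operatorname{Re}\operatorname{Tr}(x^*y)$, where $x^*$ is the conjugate transpose, and let $J=\begin{pmatrix}0&-1\\1&0\end{pmatrix}$. Let $M$ be one of the following subsets of such a space: \begin{itemize} \item $O(n;\mathbb F)=\{x\in M(n;\mathbb F)\mid x^*x=I_n\}$ with $\mathbb F=\mathbb R$, $\mathbb C$ or $\mathbb H$; \item $G_{n,k}=\{x\in M(n;\mathbb C)\mid x^*=x,\ x^2=I_n,\ x\text{ has exactly }k\text{ negative eigenvalues, counted with multiplicity}\}$; \item $LG_n=\{x\in M(n;\mathbb C)\mid x^{\tau}=x,\ \overline{x}x=I_n\}$; \item $\mathbb CS_n=\{x\in M(2n;\mathbb R)\mid x^{\tau}=-x,\ x^2=-I_{2n}\}$. \end{itemize} Let $a=\lambda_1J\oplus\dots\oplus\lambda_nJ$ if $M=\mathbb CS_n$ and $a=\operatorname{diag}(\lambda_1,\dots,\lambda_n)$ otherwise. For $I=\{i_1<\dots<i_r\}\subseteq\{1,\dots,n\}$ put $\varepsilon_j=-1$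 if $j\in I$ and $\varepsilon_j=1$ if $j\notin I$, and let $\sigma_I=\varepsilon_1J\oplus\dots\oplus\varepsilon_nJ$ if $M=\mathbb CS_n$ and $\sigma_I=\operatorname{diag}(\varepsilon_1,\dots,\varepsilon_n)$ otherwise. Then $M$ is a smooth submanifold, and the function $f_a:M\to\mathbb R$, $f_a(x)=\|x-a\|^2$, is a Morse function on $M$: it is smooth and all its critical points are non-degenerate. Further: (1) The set of critical points of $f_a$ is $\{\sigma_I\mid I\subseteq\{1,\dots,n\}\}$ if $M\neq G_{n,k}$, and $\{\sigma_I\mid I\subseteq\{1,\dots,n\},\ |I|=k\}$ if $M=G_{n,k}$. (2) The index of the critical point $\sigma_I$, $I=\{i_1<\dots<i_r\}$ (with $r=k$ if $M=G_{n,k}$), is \[ \operatorname{Ind}(\sigma_I)=\begin{cases} \dim_{\mathbb R}\mathbb F\cdot(i_1+\dots+i_r)-r & \text{if } M=O(n;\mathbb F),\\ 2(i_1+\dots+i_r-r) & \text{if } M=\mathbb CS_n,\\ i_1+\dots+i_r & \text{if } M=LG_n,\\ 2\sum_{s=1}^{k}(i_s-s) & \text{if } M=G_{n,k}. \end{cases}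 \] -/

import Mathlib

open scoped ContDiff Matrix

/-! ### Smooth submanifolds, critical points, Hessians, Morse functions -/

/-- Local coordinates of dimension `d` on the subset `M` of the normed space `E`, centered at `p`:
a diffeomorphism between an open neighborhood `source` of `0` in `ℝ^d` and an open neighborhood
`M ∩ target` of `p` in `M`. The map `param` is the diffeomorphism, and its inverse is the
restriction to `M ∩ target` of the map `coord`, smooth on the open set `target`. -/
structure LocalCoordinates {E : Type*} [NormedAddCommGroup E] [NormedSpace ℝ E]
    (M : Set E) (p : E) (d : ℕ) where
  param : EuclideanSpace ℝ (Fin d) → E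
  coord : E → EuclideanSpace ℝ (Fin d)
  source : Set (EuclideanSpace ℝ (Fin d))
  target : Set E
  isOpen_source : IsOpen source
  isOpen_target : IsOpen target
  contDiffOn_param : ContDiffOn ℝ ∞ param source
  contDiffOn_coord : ContDiffOn ℝ ∞ coord target
  mapsTo_param : Set.MapsTo param source (M ∩ target)
  mapsTo_coord : Set.MapsTo coord (M ∩ target) source
  coord_param : ∀ u ∈ source, coord (param u) = u
  param_coord : ∀ x ∈ M ∩ target, param (coord x) = x
  zero_mem_source : (0 : EuclideanSpace ℝ (Fin d)) ∈ source
  param_zero : param 0 = p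

/-- `M` is a smooth (embedded) submanifold of dimension `d` of `E`. -/
def IsSmoothSubmanifold {E : Type*} [NormedAddCommGroup E] [NormedSpace ℝ E]
    (M : Set E) (d : ℕ) : Prop :=
  ∀ p ∈ M, Nonempty (LocalCoordinates M p d)

/-- The restriction of `f` to `M` is smooth: it is smooth in all local coordinates. -/
def IsSmoothOnSubmanifold {E : Type*} [NormedAddCommGroup E] [NormedSpace ℝ E]
    (M : Set E) (f : E → ℝ) : Prop :=
  ∀ (p : E) (d : ℕ) (c : LocalCoordinates M p d), ContDiffOn ℝ ∞ (f ∘ c.param) c.source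

/-- The set of critical points of `f` restricted to `M`: all first partial derivatives of `f`
in local coordinates centered at the point vanish. -/
def criticalSet {E : Type*} [NormedAddCommGroup E] [NormedSpace ℝ E]
    (M : Set E) (f : E → ℝ) : Set E :=
  {p | ∃ (d : ℕ) (c : LocalCoordinates M p d), fderiv ℝ (f ∘ c.param) 0 = 0}

/-- The Hessian form of `f` at `p` in local coordinates `c` centered at `p`, as the bilinear form
`∑ u_i v_j ∂²f/∂x_i∂x_j (0)`. (A factor `1/2` changes neither non-degeneracy nor index.) -/
noncomputable def hessian {E : Type*} [NormedAddCommGroup E] [NormedSpace ℝ E]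
    {M : Set E} {p : E} {d : ℕ} (f : E → ℝ) (c : LocalCoordinates M p d) :
    LinearMap.BilinForm ℝ (EuclideanSpace ℝ (Fin d)) :=
  (fderiv ℝ (fderiv ℝ (f ∘ c.param)) 0).toBilinForm

/-- `f` restricts to a Morse function on the smooth submanifold `M`. -/
structure IsMorseFunction {E : Type*} [NormedAddCommGroup E] [NormedSpace ℝ E]
    (M : Set E) (f : E → ℝ) : Prop where
  submanifold : ∃ d, IsSmoothSubmanifold M d
  smooth : IsSmoothOnSubmanifold M f
  nondegenerate : ∀ p ∈ criticalSet M f, ∀ (d : ℕ) (c : LocalCoordinates M p d),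
    (hessian f c).Nondegenerate

/-- `p` is a non-degenerate critical point of `f` restricted to `M`, of index `r` (in whichever
local coordinates centered at `p`). The index `sigNeg`, compared with `r` in `ℤ`, is the maximal
dimension of a subspace on which the Hessian form is negative definite, which is the number of
`-1`s in the normal form `0_s ⊕ (-I_r) ⊕ I_t`. -/
def HasMorseIndex {E : Type*} [NormedAddCommGroup E] [NormedSpace ℝ E]
    (M : Set E) (f : E → ℝ) (p : E) (r : ℤ) : Prop :=
  p ∈ criticalSet M f ∧ ∀ (d : ℕ) (c : LocalCoordinates M p d),
    (hessian f c).Nondegenerate ∧ (sigNeg (hessian f c).toQuadraticMap : ℤ) = r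

/-- The distance-squared function from the point `a`. -/
def distSq {E : Type*} [NormedAddCommGroup E] (a : E) : E → ℝ := fun x => ‖x - a‖ ^ 2

/-! ### The matrix spaces

Spaces of matrices carry the Euclidean norm `‖x‖ = √(∑ |x_ij|²)`, which comes from the inner
product `⟨x, y⟩ = Re Tr (x* y)`. -/

attribute [local instance] Matrix.frobeniusNormedAddCommGroup Matrix.frobeniusNormedSpace

/-- `O(n;𝔽)`: the orthogonal, unitary or symplectic group for `𝔽 = ℝ, ℂ, ℍ`. -/
def orthogonalManifold (n : ℕ) (𝔽 : Type) [Ring 𝔽] [StarRing 𝔽] :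
    Set (Matrix (Fin n) (Fin n) 𝔽) :=
  {x | xᴴ * x = 1}

/-- The Grassmannian `G_{n,k}`: Hermitian involutions with exactly `k` negative eigenvalues,
counted with multiplicity. -/
def grassmannManifold (n k : ℕ) : Set (Matrix (Fin n) (Fin n) ℂ) :=
  {x | ∃ hx : x.IsHermitian, x * x = 1 ∧
    (Finset.univ.filter fun i => hx.eigenvalues i < 0).card = k}

/-- The Lagrangian Grassmannian `LG_n`: complex symmetric matrices with `x̄ x = 1`. -/
def lagrangianManifold (n : ℕ) : Set (Matrix (Fin n) (Fin n) ℂ) :=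
  {x | xᵀ = x ∧ x.map (starRingEnd ℂ) * x = 1}

/-- `ℂS_n`: real skew-symmetric matrices of size `2n` with `x² = -1`. The `2n` coordinates are
indexed by pairs `(j, i)`, with `i : Fin n` the number of the `2 × 2` block and `j : Fin 2` the
position inside the block. -/
def complexStructureManifold (n : ℕ) : Set (Matrix (Fin 2 × Fin n) (Fin 2 × Fin n) ℝ) :=
  {x | xᵀ = -x ∧ x * x = -1}

/-- The diagonal matrix `diag (v_1, …, v_n)` with real entries, as a matrix over `𝔽`. -/
def realDiagonal {n : ℕ} (𝔽 : Type) [Ring 𝔽] [Algebra ℝ 𝔽] (v : Fin n → ℝ) :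
    Matrix (Fin n) (Fin n) 𝔽 :=
  Matrix.diagonal fun i => algebraMap ℝ 𝔽 (v i)

/-- The block diagonal matrix `v_1 J ⊕ ⋯ ⊕ v_n J`. -/
def blockJ {n : ℕ} (v : Fin n → ℝ) : Matrix (Fin 2 × Fin n) (Fin 2 × Fin n) ℝ :=
  Matrix.blockDiagonal fun i => v i • !![0, -1; 1, 0]

/-- The signs `ε_i`: `-1` if `i ∈ I`, and `1` otherwise. -/
def signs {n : ℕ} (I : Finset (Fin n)) : Fin n → ℝ := fun i => if i ∈ I then -1 else 1

/-- The sum `i_1 + ⋯ + i_r` of the elements of `I ⊆ {1, …, n}`; the number `i` is represented by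
the element `i - 1` of `Fin n`. -/
def indexSum {n : ℕ} (I : Finset (Fin n)) : ℤ := ∑ i ∈ I, ((i : ℕ) + 1 : ℤ)

/-!
All four spaces consist of unitary elements `x* x = 1` of a finite-dimensional real star algebra `E`
with an invariant trace form: they are the unitary elements of a linear subspace `V` that is closed
under `(x, y) ↦ x y* x` and `x ↦ (x⁻¹)*`, intersected with an open set in the case of the
Grassmannians (`UnitarySlice`). For such a set `M`, the Cayley transform
`y ↦ 2 p (p - y)⁻¹ p - p` maps a neighborhood of `0` in `T_p = {h ∈ V | p* h + h* p = 0}`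
diffeomorphically to a neighborhood of `p` in `M` (`UnitarySlice.nonempty_localCoordinates`), and in
arbitrary local coordinates `φ` at `p` the derivative of `φ` is an isomorphism to `T_p`
(`UnitarySlice.range_fderiv_param`).

Since `T_p` is the `-1`-eigenspace of the isometric involution `h ↦ p h* p` of `V`, and `a ∈ V`, the
point `p` is critical for `f_a` if and only if `a = p a* p`, that is, `p* a` is self-adjoint
(`UnitarySlice.mem_criticalSet_iff`). Then `p` commutes with `a²`, which has distinct eigenvalues on
the blocks, and this leaves only the points `σ_I` (`Matrix.eq_realDiagonal_signs`,
`Matrix.eq_blockJ_signs`). At a critical point, `f_a(x) = f_a(p) + tr (p* a (x - p)* (x - p))` for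
all `x ∈ M` (`UnitarySlice.distSq_eq_add_weighted`): there is no linear term, so that second
derivatives of the coordinates do not enter, and the Hessian form is `2 tr (p* a h* h)` on `T_p`
(`UnitarySlice.hessian_apply`). At `σ_I` it equals `∑ (ε_x λ_x + ε_y λ_y) |h_xy|²`, where the sign
of the coefficient is that of `ε_(max (x, y))`. The tangent vectors supported in the positions with
`max (x, y) ∈ I` and those supported in the other positions are therefore a negative and a positive
definite summand of `T_p` (`Matrix.nondegenerate_and_sigNeg`).

The dimensions of the tangent spaces, which have to be constant on `M`, and of the negative
summands are traces of projections. These traces are sums of the contributions of the matrix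
positions (`Matrix.trace_maskEntries_comp`), which are computed for each of the spaces.
-/

/-! ### Local coordinates and the signature of a bilinear form -/

section Charts

variable {E : Type*} [NormedAddCommGroup E] [NormedSpace ℝ E] {M : Set E} {p : E}

namespace LocalCoordinates

variable {d : ℕ} (c : LocalCoordinates M p d)

lemma source_mem_nhds : c.source ∈ nhds (0 : EuclideanSpace ℝ (Fin d)) :=
  c.isOpen_source.mem_nhds c.zero_mem_source

lemma contDiffAt_param : ContDiffAt ℝ ∞ c.param 0 :=
  c.contDiffOn_param.contDiffAt c.source_mem_nhds

lemma hasFDerivAt_param : HasFDerivAt c.param (fderiv ℝ c.param 0) 0 :=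
  (c.contDiffAt_param.differentiableAt (by simp)).hasFDerivAt

lemma mem (c : LocalCoordinates M p d) : p ∈ M := by
  have := c.mapsTo_param c.zero_mem_source
  rw [c.param_zero] at this
  exact this.1

lemma mem_target : p ∈ c.target := by
  have := c.mapsTo_param c.zero_mem_source
  rw [c.param_zero] at this
  exact this.2

lemma hasFDerivAt_coord : HasFDerivAt c.coord (fderiv ℝ c.coord p) p :=
  ((c.contDiffOn_coord.contDiffAt (c.isOpen_target.mem_nhds c.mem_target)).differentiableAt
    (by simp)).hasFDerivAt

/-- The derivative of `coord` is a left inverse of that of `param`. -/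
lemma fderiv_param_injective : Function.Injective (fderiv ℝ c.param 0) := by
  have h1 : HasFDerivAt (c.coord ∘ c.param)
      ((fderiv ℝ c.coord p).comp (fderiv ℝ c.param 0)) 0 := by
    refine HasFDerivAt.comp 0 ?_ c.hasFDerivAt_param
    rw [c.param_zero]
    exact c.hasFDerivAt_coord
  have h2 : HasFDerivAt (c.coord ∘ c.param)
      (ContinuousLinearMap.id ℝ (EuclideanSpace ℝ (Fin d))) 0 := by
    refine (hasFDerivAt_id _).congr_of_eventuallyEq ?_
    filter_upwards [c.source_mem_nhds] with u hu using c.coord_param u hu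
  have h3 := h1.unique h2
  intro u v huv
  have := congrArg (fderiv ℝ c.coord p) huv
  rw [← ContinuousLinearMap.comp_apply, ← ContinuousLinearMap.comp_apply, h3] at this
  simpa using this

/-- The image of the derivative of `param` does not depend on the coordinates: near `0`, the map
`c'.param` factors through `c.param`. -/
lemma range_fderiv_param_le {d' : ℕ} (c' : LocalCoordinates M p d') :
    (fderiv ℝ c'.param 0).range ≤ (fderiv ℝ c.param 0).range := by
  have h1 : HasFDerivAt (c.param ∘ (c.coord ∘ c'.param))
      ((fderiv ℝ c.param 0).comp ((fderiv ℝ c.coord p).comp (fderiv ℝ c'.param 0))) 0 := by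
    have h0 : c.coord p = 0 := by
      have h := c.coord_param 0 c.zero_mem_source
      rwa [c.param_zero] at h
    refine HasFDerivAt.comp 0 ?_ (HasFDerivAt.comp 0 ?_ c'.hasFDerivAt_param)
    · simp only [Function.comp_apply, c'.param_zero, h0]
      exact c.hasFDerivAt_param
    · rw [c'.param_zero]
      exact c.hasFDerivAt_coord
  have h2 : HasFDerivAt (c.param ∘ (c.coord ∘ c'.param)) (fderiv ℝ c'.param 0) 0 := by
    refine c'.hasFDerivAt_param.congr_of_eventuallyEq ?_
    have ht : ∀ᶠ u in nhds 0, c'.param u ∈ c.target := by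
      refine c'.hasFDerivAt_param.continuousAt ?_
      rw [c'.param_zero]
      exact c.isOpen_target.mem_nhds c.mem_target
    filter_upwards [c'.source_mem_nhds, ht] with u hu hu'
    exact c.param_coord _ ⟨(c'.mapsTo_param hu).1, hu'⟩
  rintro _ ⟨u, rfl⟩
  refine ⟨fderiv ℝ c.coord p (fderiv ℝ c'.param 0 u), ?_⟩
  have := h1.unique h2
  exact DFunLike.congr_fun this u

end LocalCoordinates

end Charts

section SignatureLemma

/-- The existence part of the law of inertia in terms of a definite splitting. -/
lemma nondegenerate_and_sigNeg_of_isCompl {X : Type*} [AddCommGroup X] [Module ℝ X]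
    [FiniteDimensional ℝ X] (B : LinearMap.BilinForm ℝ X) (hB : ∀ u v, B u v = B v u)
    (N P : Submodule ℝ X) (hNP : IsCompl N P)
    (hN : ∀ x ∈ N, x ≠ 0 → B x x < 0) (hP : ∀ x ∈ P, x ≠ 0 → 0 < B x x) :
    B.Nondegenerate ∧ sigNeg B.toQuadraticMap = Module.finrank ℝ N := by
  have hN' : ∀ x ∈ N, B x x ≤ 0 := fun x hx => by
    by_cases h : x = 0
    · simp [h]
    · exact (hN x hx h).le
  have hpos : Module.finrank ℝ P ≤ sigPos B.toQuadraticMap := by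
    refine le_sigPos_of_posDef _ ?_
    rintro ⟨x, hx⟩ hx0
    exact hP x hx (fun h => hx0 (Subtype.ext h))
  have hneg : Module.finrank ℝ N ≤ sigNeg B.toQuadraticMap := by
    refine le_sigNeg_of_negDef _ ?_
    rintro ⟨x, hx⟩ hx0
    have := hN x hx (fun h => hx0 (Subtype.ext h))
    simpa using this
  have hsum := QuadraticForm.sigPos_add_sigNeg_add_radical (Q := B.toQuadraticMap)
  have hd := Submodule.finrank_add_eq_of_isCompl hNP
  refine ⟨?_, by omega⟩
  have hsymm : B.IsSymm := ⟨fun x y => by simpa using hB x y⟩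
  refine (LinearMap.IsRefl.nondegenerate_iff_separatingLeft hsymm.isRefl).2 ?_
  intro x hx
  obtain ⟨a, ha, b, hb, rfl⟩ : ∃ a ∈ N, ∃ b ∈ P, a + b = x := by
    have : x ∈ N ⊔ P := by rw [hNP.sup_eq_top]; trivial
    exact Submodule.mem_sup.1 this
  have h1 := hx a
  have h2 := hx b
  simp only [map_add, LinearMap.add_apply] at h1 h2
  have hab := hB a b
  have ha0 : a = 0 := by
    by_contra h
    have := hN a ha h
    by_cases hb0 : b = 0
    · subst hb0; simp at h1; linarith
    · have := hP b hb hb0; linarith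
  subst ha0
  have hb0 : b = 0 := by
    by_contra h
    have := hP b hb h
    simp at h2; linarith
  simp [hb0]

end SignatureLemma

/-! ### The Cayley transform -/

lemma Ring.inverse_eq_of_mul_eq_one {R : Type*} [Ring R] {x y : R} (h : x * y = 1)
    (h' : y * x = 1) : Ring.inverse x = y :=
  Ring.inverse_unit ⟨x, y, h, h'⟩

section Cayley

variable {E : Type*} [Ring E] [Algebra ℝ E]

/-- The Cayley transform centered at `p`: for unitary `p` it maps a tangent vector `y` at `p` to
`p (1 + p* y) (1 - p* y)⁻¹`. -/
noncomputable def cayleyMap (p y : E) : E := (2 : ℝ) • (p * Ring.inverse (p - y) * p) - p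

lemma cayleyMap_zero {p q : E} (hpq : p * q = 1) (hqp : q * p = 1) : cayleyMap p 0 = p := by
  rw [cayleyMap, sub_zero, Ring.inverse_eq_of_mul_eq_one hpq hqp, hpq, one_mul, two_smul,
    add_sub_cancel_right]

/-- With `w = (p - y)⁻¹` and `q = p⁻¹`, the sum `p + cayleyMap p y = 2 p w p` has the inverse
`q (p - y) q / 2`. -/
lemma cayleyMap_inverse_aux {p q y w : E} (hpq : p * q = 1) (hqp : q * p = 1)
    (h : (p - y) * w = 1) (h' : w * (p - y) = 1) :
    (p + cayleyMap p y) * ((1 / 2 : ℝ) • (q * (p - y) * q)) = 1 ∧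
      ((1 / 2 : ℝ) • (q * (p - y) * q)) * (p + cayleyMap p y) = 1 := by
  have h1 : p + cayleyMap p y = (2 : ℝ) • (p * w * p) := by
    rw [cayleyMap, Ring.inverse_eq_of_mul_eq_one h h', add_sub_cancel]
  have e1 : p * w * p * (q * (p - y) * q) = 1 := by
    calc p * w * p * (q * (p - y) * q) = p * w * (p * q) * (p - y) * q := by noncomm_ring
      _ = p * (w * (p - y)) * q := by rw [hpq]; noncomm_ring
      _ = 1 := by rw [h', mul_one, hpq]
  have e2 : q * (p - y) * q * (p * w * p) = 1 := by
    calc q * (p - y) * q * (p * w * p) = q * (p - y) * (q * p) * w * p := by noncomm_ring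
      _ = q * ((p - y) * w) * p := by rw [hqp]; noncomm_ring
      _ = 1 := by rw [h, mul_one, hqp]
  rw [h1, smul_mul_smul_comm, smul_mul_smul_comm, e1, e2]
  norm_num

lemma isUnit_add_cayleyMap {p q y : E} (hpq : p * q = 1) (hqp : q * p = 1)
    (h : IsUnit (p - y)) : IsUnit (p + cayleyMap p y) := by
  obtain ⟨u, hu⟩ := h
  have := cayleyMap_inverse_aux (y := y) (w := ↑u⁻¹) hpq hqp (by simp [← hu]) (by simp [← hu])
  exact ⟨⟨_, _, this.1, this.2⟩, rfl⟩

/-- The map `x ↦ -cayleyMap p (-x)` inverts the Cayley transform. -/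
lemma cayleyMap_neg_cayleyMap {p q y : E} (hpq : p * q = 1) (hqp : q * p = 1)
    (h : IsUnit (p - y)) : cayleyMap p (-cayleyMap p y) = -y := by
  obtain ⟨u, hu⟩ := h
  obtain ⟨h1, h2⟩ :=
    cayleyMap_inverse_aux (y := y) (w := ↑u⁻¹) hpq hqp (by simp [← hu]) (by simp [← hu])
  rw [cayleyMap, sub_neg_eq_add, Ring.inverse_eq_of_mul_eq_one h1 h2, mul_smul_comm, smul_mul_assoc,
    smul_smul]
  have : p * (q * (p - y) * q) * p = p - y := by
    calc p * (q * (p - y) * q) * p = (p * q) * (p - y) * (q * p) := by noncomm_ring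
      _ = p - y := by rw [hpq, hqp, one_mul, mul_one]
  rw [this]
  norm_num

variable [StarRing E]

/-- The Cayley transform maps tangent vectors at `p` to unitary elements. -/
lemma star_cayleyMap_mul_self {p y : E} (hp : star p * p = 1)
    (hy : star p * y + star y * p = 0) (h : IsUnit (p - y)) :
    star (cayleyMap p y) * cayleyMap p y = 1 := by
  obtain ⟨u, hu⟩ := h
  set w : E := ↑u⁻¹ with hw
  have h1 : (p - y) * w = 1 := by simp [← hu, hw]
  have h2 : w * (p - y) = 1 := by simp [← hu, hw]
  have e1 : cayleyMap p y = (p + y) * w * p := by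
    rw [cayleyMap, Ring.inverse_eq_of_mul_eq_one h1 h2, two_smul]
    calc p * w * p + p * w * p - p = p * w * p + p * w * p - 1 * p := by rw [one_mul]
      _ = (p + y) * w * p := by rw [← h1]; noncomm_ring
  have e2 : star (p + y) * (p + y) = star (p - y) * (p - y) := by
    rw [star_add, star_sub]
    have : (star p + star y) * (p + y) - (star p - star y) * (p - y)
        = (2 : ℕ) • (star p * y + star y * p) := by noncomm_ring
    rw [hy, smul_zero] at this
    exact sub_eq_zero.1 this
  rw [e1]
  calc star ((p + y) * w * p) * ((p + y) * w * p)
      = star p * star w * (star (p + y) * (p + y)) * w * p := by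
        simp only [star_mul]; noncomm_ring
    _ = star p * star ((p - y) * w) * ((p - y) * w) * p := by
        rw [e2]; simp only [star_mul]; noncomm_ring
    _ = 1 := by rw [h1, star_one, mul_one, mul_one, hp]

variable [StarModule ℝ E]

/-- The inverse Cayley transform maps unitary elements to tangent vectors at `p`. -/
lemma tangent_cayleyMap_neg {p x : E} (hp : star p * p = 1) (hp' : p * star p = 1)
    (hx : x * star x = 1) (h : IsUnit (p + x)) :
    star p * cayleyMap p (-x) + star (cayleyMap p (-x)) * p = 0 := by
  obtain ⟨u, hu⟩ := h
  set w : E := ↑u⁻¹ with hw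
  have h1 : (p + x) * w = 1 := by simp [← hu, hw]
  have h2 : w * (p + x) = 1 := by simp [← hu, hw]
  have h1' : star w * star (p + x) = 1 := by rw [← star_mul, h1, star_one]
  have h2' : star (p + x) * star w = 1 := by rw [← star_mul, h2, star_one]
  have key : w * p + star p * star w = 1 := by
    have e : p * star (p + x) + (p + x) * star p = (p + x) * star (p + x) := by
      rw [star_add]
      calc p * (star p + star x) + (p + x) * star p
          = p * star p + p * star x + x * star p + p * star p := by noncomm_ring
        _ = p * star p + p * star x + x * star p + x * star x := by rw [hx, hp']
        _ = _ := by noncomm_ring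
    calc w * p + star p * star w
        = w * p * (star (p + x) * star w) + (w * (p + x)) * star p * star w := by
          rw [h2, h2', one_mul, mul_one]
      _ = w * (p * star (p + x) + (p + x) * star p) * star w := by noncomm_ring
      _ = (w * (p + x)) * (star (p + x) * star w) := by rw [e]; noncomm_ring
      _ = 1 := by rw [h2, h2', one_mul]
  rw [cayleyMap, sub_neg_eq_add, Ring.inverse_eq_of_mul_eq_one h1 h2]
  simp only [star_sub, star_smul, star_mul, star_trivial, mul_sub, sub_mul, mul_smul_comm,
    smul_mul_assoc, hp]
  calc (2 : ℝ) • (star p * (p * w * p)) - 1 + ((2 : ℝ) • (star p * (star w * star p) * p) - 1)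
      = (2 : ℝ) • ((star p * p) * w * p) - 1
          + ((2 : ℝ) • (star p * star w * (star p * p)) - 1) := by
        simp only [mul_assoc]
    _ = (2 : ℝ) • (w * p + star p * star w) - (2 : ℝ) • 1 := by
        rw [hp, one_mul, mul_one, smul_add, two_smul ℝ (1 : E)]; abel
    _ = 0 := by rw [key, sub_self]

end Cayley

/-! ### Slices of the unitary elements and their tangent spaces -/

section Slices

variable {E : Type*} [NormedRing E] [NormedAlgebra ℝ E]

lemma contDiffOn_cayleyMap [FiniteDimensional ℝ E] (p : E) :
    ContDiffOn ℝ ∞ (cayleyMap p) {y | IsUnit (p - y)} := by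
  have : CompleteSpace E := FiniteDimensional.complete ℝ E
  rintro y ⟨u, hu⟩
  apply ContDiffAt.contDiffWithinAt
  have h : ContDiffAt ℝ ∞ (fun y => Ring.inverse (p - y)) y := by
    refine ContDiffAt.comp (g := Ring.inverse) (f := fun y => p - y) y ?_ (by fun_prop)
    rw [← hu]
    exact contDiffAt_ringInverse ℝ u
  exact ((contDiffAt_const.mul h).mul contDiffAt_const |>.const_smul (2 : ℝ)).sub contDiffAt_const

lemma isOpen_setOf_isUnit_comp [FiniteDimensional ℝ E] {X : Type*} [TopologicalSpace X]
    {f : X → E} (hf : Continuous f) : IsOpen {y | IsUnit (f y)} := by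
  have : CompleteSpace E := FiniteDimensional.complete ℝ E
  exact Units.isOpen.preimage hf

variable [StarRing E]

/-- In finite dimensions left inverses are right inverses. -/
lemma mul_star_self_of_star_mul_self [FiniteDimensional ℝ E] {x : E} (hx : star x * x = 1) :
    x * star x = 1 := by
  have hinj : Function.Injective (LinearMap.mulLeft ℝ x) := by
    intro a b hab
    have := congrArg (star x * ·) hab
    simpa [← mul_assoc, hx] using this
  obtain ⟨y, hy⟩ := LinearMap.injective_iff_surjective.1 hinj 1
  have hy' : x * y = 1 := hy
  have : y = star x := by
    calc y = star x * x * y := by rw [hx, one_mul]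
      _ = star x := by rw [mul_assoc, hy', mul_one]
  rw [← this, hy']

/-- The conjugate transpose as a continuous linear map. -/
noncomputable def starCLM (E : Type*) [NormedRing E] [NormedAlgebra ℝ E] [StarRing E]
    [StarModule ℝ E] [FiniteDimensional ℝ E] : E →L[ℝ] E :=
  LinearMap.toContinuousLinearMap
    { toFun := star, map_add' := star_add, map_smul' := fun r x => by simp [star_smul] }

@[simp] lemma starCLM_apply [StarModule ℝ E] [FiniteDimensional ℝ E] (x : E) :
    starCLM E x = star x := rfl

variable (E) in
/-- The data cutting out a set of unitary elements of `E`: a linear subspace that is closed under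
`(x, y) ↦ x y* x` and `x ↦ (x⁻¹)*`, and an open set, which serves to
select connected components of the set of unitary elements of the subspace. -/
structure UnitarySlice where
  space : Submodule ℝ E
  dom : Set E
  isOpen_dom : IsOpen dom
  sandwich_mem : ∀ {x y}, x ∈ space → y ∈ space → x * star y * x ∈ space
  star_inverse_mem : ∀ {x y}, x ∈ space → x * y = 1 → y * x = 1 → star y ∈ space

namespace UnitarySlice

variable (S : UnitarySlice E)

/-- The unitary elements of a slice. -/
def carrier : Set E := {x | x ∈ S.space ∧ x ∈ S.dom ∧ star x * x = 1}

variable [StarModule ℝ E]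

/-- The tangent space of `S.carrier` at the point `p`. -/
def tangent (p : E) : Submodule ℝ E where
  carrier := {h | h ∈ S.space ∧ star p * h + star h * p = 0}
  add_mem' := by
    rintro a b ⟨ha, ha'⟩ ⟨hb, hb'⟩
    refine ⟨add_mem ha hb, ?_⟩
    rw [mul_add, star_add, add_mul, add_add_add_comm, ha', hb', add_zero]
  zero_mem' := by simp
  smul_mem' := by
    rintro r a ⟨ha, ha'⟩
    refine ⟨S.space.smul_mem r ha, ?_⟩
    rw [star_smul, star_trivial r, mul_smul_comm, smul_mul_assoc, ← smul_add, ha', smul_zero]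

variable {S} {p : E}

omit [StarModule ℝ E] in
lemma cayleyMap_mem_space {y : E} (hp : p ∈ S.space) (hy : y ∈ S.space) (h : IsUnit (p - y)) :
    cayleyMap p y ∈ S.space := by
  obtain ⟨u, hu⟩ := h
  rw [cayleyMap, ← hu, Ring.inverse_unit]
  refine sub_mem (S.space.smul_mem _ ?_) hp
  have : star (↑u⁻¹ : E) ∈ S.space := by
    refine S.star_inverse_mem (x := ↑u) ?_ u.mul_inv u.inv_mul
    rw [hu]
    exact sub_mem hp hy
  simpa using S.sandwich_mem hp this

variable [FiniteDimensional ℝ E]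

/-- The Cayley transform provides local coordinates at each point of the slice. -/
lemma nonempty_localCoordinates (hp : p ∈ S.carrier) :
    Nonempty (LocalCoordinates S.carrier p (Module.finrank ℝ (S.tangent p))) := by
  obtain ⟨hpV, hpO, hpp⟩ := hp
  have hpp' := mul_star_self_of_star_mul_self hpp
  set d := Module.finrank ℝ (S.tangent p)
  let e : EuclideanSpace ℝ (Fin d) ≃L[ℝ] S.tangent p :=
    ContinuousLinearEquiv.ofFinrankEq (by simp [d])
  let ι : EuclideanSpace ℝ (Fin d) →L[ℝ] E := (S.tangent p).subtypeL.comp e.toContinuousLinearMap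
  have hι : ∀ u, ι u ∈ S.tangent p := fun u => (e u).2
  obtain ⟨π, hπ⟩ : ∃ π : E →L[ℝ] EuclideanSpace ℝ (Fin d), ∀ u, π (ι u) = u := by
    obtain ⟨g, hg⟩ := (ι : EuclideanSpace ℝ (Fin d) →ₗ[ℝ] E).exists_leftInverse_of_injective
      (LinearMap.ker_eq_bot.2 (Subtype.val_injective.comp e.injective))
    exact ⟨LinearMap.toContinuousLinearMap g, fun u => DFunLike.congr_fun hg u⟩
  have hιπ : ∀ h ∈ S.tangent p, ι (π h) = h := by
    intro h hh
    have : ι (e.symm ⟨h, hh⟩) = h := by simp [ι]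
    rw [← this, hπ]
  have hunit : IsOpen {u | IsUnit (p - ι u)} :=
    isOpen_setOf_isUnit_comp (by fun_prop)
  have hΦ : ContDiffOn ℝ ∞ (fun u => cayleyMap p (ι u)) {u | IsUnit (p - ι u)} :=
    (contDiffOn_cayleyMap p).comp ι.contDiff.contDiffOn (fun u hu => hu)
  have hinv : ∀ {x}, IsUnit (p + x) → cayleyMap p (-cayleyMap p (-x)) = x := by
    intro x hx
    rw [cayleyMap_neg_cayleyMap hpp' hpp (by rwa [sub_neg_eq_add]), neg_neg]
  have htan : ∀ {x}, x ∈ S.carrier → IsUnit (p + x) → -cayleyMap p (-x) ∈ S.tangent p := by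
    rintro x ⟨hxV, hxO, hxx⟩ hx
    refine neg_mem ⟨cayleyMap_mem_space hpV (neg_mem hxV) (by rwa [sub_neg_eq_add]), ?_⟩
    exact tangent_cayleyMap_neg hpp hpp' (mul_star_self_of_star_mul_self hxx) hx
  refine ⟨{
    param := fun u => cayleyMap p (ι u)
    coord := fun x => π (-cayleyMap p (-x))
    source := {u | IsUnit (p - ι u)} ∩ (fun u => cayleyMap p (ι u)) ⁻¹' S.dom
    target := {x | IsUnit (p + x)} ∩ S.dom
    isOpen_source := hΦ.continuousOn.isOpen_inter_preimage hunit S.isOpen_dom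
    isOpen_target := (isOpen_setOf_isUnit_comp (by fun_prop)).inter S.isOpen_dom
    contDiffOn_param := hΦ.mono Set.inter_subset_left
    contDiffOn_coord := ?_
    mapsTo_param := ?_
    mapsTo_coord := ?_
    coord_param := ?_
    param_coord := ?_
    zero_mem_source := ?_
    param_zero := by rw [map_zero, cayleyMap_zero hpp' hpp] }⟩
  · refine π.contDiff.comp_contDiffOn (ContDiffOn.neg ?_)
    refine (contDiffOn_cayleyMap p).comp contDiff_neg.contDiffOn ?_
    rintro x ⟨hx, -⟩
    simpa using hx
  · rintro u ⟨hu, huO⟩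
    exact ⟨⟨cayleyMap_mem_space hpV (hι u).1 hu, huO,
      star_cayleyMap_mul_self hpp (hι u).2 hu⟩, isUnit_add_cayleyMap hpp' hpp hu, huO⟩
  · rintro x ⟨hxM, hx, hxO⟩
    have h := hιπ _ (htan hxM hx)
    refine ⟨?_, ?_⟩
    · rw [Set.mem_ofPred_eq, h, sub_neg_eq_add]
      exact isUnit_add_cayleyMap hpp' hpp (by rwa [sub_neg_eq_add])
    · simp only [Set.mem_preimage]
      rw [h, hinv hx]
      exact hxO
  · rintro u ⟨hu, -⟩
    rw [cayleyMap_neg_cayleyMap hpp' hpp hu, neg_neg, hπ]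
  · rintro x ⟨hxM, hx, hxO⟩
    rw [hιπ _ (htan hxM hx), hinv hx]
  · refine ⟨?_, ?_⟩
    · exact ⟨⟨p, star p, hpp', hpp⟩, by simp⟩
    · simp only [Set.mem_preimage]
      rw [map_zero, cayleyMap_zero hpp' hpp]
      exact hpO

lemma isSmoothSubmanifold {d : ℕ}
    (h : ∀ p ∈ S.carrier, Module.finrank ℝ (S.tangent p) = d) :
    IsSmoothSubmanifold S.carrier d := by
  intro p hp
  rw [← h p hp]
  exact nonempty_localCoordinates hp

/-- In any local coordinates the derivative of `param` maps onto the tangent space. -/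
lemma range_fderiv_param {d : ℕ} (c : LocalCoordinates S.carrier p d) :
    (fderiv ℝ c.param 0).range = S.tangent p := by
  have hle : ∀ {d : ℕ} (c : LocalCoordinates S.carrier p d),
      (fderiv ℝ c.param 0).range ≤ S.tangent p := by
    rintro d c _ ⟨u, rfl⟩
    refine ⟨?_, ?_⟩
    · by_contra hu
      obtain ⟨f, hfu, hf⟩ := Submodule.exists_le_ker_of_notMem hu
      have h1 := (LinearMap.toContinuousLinearMap f).hasFDerivAt.comp 0 c.hasFDerivAt_param
      have h2 : HasFDerivAt (LinearMap.toContinuousLinearMap f ∘ c.param)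
          (0 : EuclideanSpace ℝ (Fin d) →L[ℝ] ℝ) 0 := by
        refine (hasFDerivAt_const (0 : ℝ) _).congr_of_eventuallyEq ?_
        filter_upwards [c.source_mem_nhds] with v hv using hf (c.mapsTo_param hv).1.1
      exact hfu (DFunLike.congr_fun (h1.unique h2) u)
    · have h1 : HasFDerivAt (fun u => star (c.param u) * c.param u) _ 0 :=
        ((starCLM E).hasFDerivAt.comp 0 c.hasFDerivAt_param).mul' c.hasFDerivAt_param
      have h2 : HasFDerivAt (fun u => star (c.param u) * c.param u)
          (0 : EuclideanSpace ℝ (Fin d) →L[ℝ] E) 0 := by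
        refine (hasFDerivAt_const (1 : E) _).congr_of_eventuallyEq ?_
        filter_upwards [c.source_mem_nhds] with v hv using (c.mapsTo_param hv).1.2.2
      have := DFunLike.congr_fun (h1.unique h2) u
      simpa [c.param_zero] using this
  refine le_antisymm (hle c) ?_
  -- Equality holds for the Cayley coordinates by dimension, and the image is the same for all
  -- coordinates.
  obtain ⟨c'⟩ := nonempty_localCoordinates c.mem
  have h : (fderiv ℝ c'.param 0).range = S.tangent p := by
    refine Submodule.eq_of_le_of_finrank_eq (hle c') ?_
    rw [LinearMap.finrank_range_of_inj c'.fderiv_param_injective]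
    simp
  rw [← h]
  exact c.range_fderiv_param_le c'

end UnitarySlice
end Slices

/-! ### Critical points and Hessians of the distance function -/

lemma HasFDerivAt.bilin_sub_self {X E : Type*} [NormedAddCommGroup X] [NormedSpace ℝ X]
    [NormedAddCommGroup E] [NormedSpace ℝ E] (B : E →L[ℝ] E →L[ℝ] ℝ)
    (hB : ∀ h k, B h k = B k h) {φ : X → E} {φ' : X →L[ℝ] E} {u : X} (q : E)
    (h : HasFDerivAt φ φ' u) :
    HasFDerivAt (fun v => B (φ v - q) (φ v - q)) ((2 : ℝ) • (B (φ u - q)).comp φ') u := by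
  have h0 := h.sub_const q
  refine ((B.hasFDerivAt.comp u h0).clm_apply h0).congr_fderiv ?_
  ext w
  simp [hB (φ' w), two_mul]

/-- A trace on a normed star algebra, with values in `ℝ`, for which `(x, y) ↦ tr (x* y)` is an inner
product inducing the norm. -/
structure TraceForm (E : Type*) [NormedRing E] [NormedAlgebra ℝ E] [StarRing E] where
  tr : E →ₗ[ℝ] ℝ
  tr_mul_comm : ∀ x y, tr (x * y) = tr (y * x)
  tr_star : ∀ x, tr (star x) = tr x
  tr_star_mul_self : ∀ x, tr (star x * x) = ‖x‖ ^ 2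

section

variable {E : Type*} [NormedRing E] [NormedAlgebra ℝ E] [StarRing E] (T : TraceForm E)

include T in
lemma TraceForm.norm_star (x : E) : ‖star x‖ = ‖x‖ := by
  have : ‖star x‖ ^ 2 = ‖x‖ ^ 2 := by
    rw [← T.tr_star_mul_self, ← T.tr_star_mul_self, star_star, T.tr_mul_comm]
  exact (pow_left_inj₀ (norm_nonneg _) (norm_nonneg _) two_ne_zero).1 this

variable [StarModule ℝ E] [FiniteDimensional ℝ E]

/-- The bilinear form `(h, k) ↦ tr (b h* k)`. -/
noncomputable def TraceForm.weighted (b : E) : E →L[ℝ] E →L[ℝ] ℝ :=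
  (ContinuousLinearMap.compL ℝ E E ℝ (LinearMap.toContinuousLinearMap T.tr)).comp
    ((ContinuousLinearMap.mul ℝ E).comp ((ContinuousLinearMap.mul ℝ E b).comp (starCLM E)))

@[simp] lemma TraceForm.weighted_apply (b h k : E) : T.weighted b h k = T.tr (b * star h * k) := rfl

lemma TraceForm.weighted_symm {b : E} (hb : star b = b) (h k : E) :
    T.weighted b h k = T.weighted b k h := by
  rw [T.weighted_apply, T.weighted_apply, ← T.tr_star, star_mul, star_mul, star_star, hb,
    ← mul_assoc, T.tr_mul_comm, mul_assoc]

lemma TraceForm.distSq_eq (a x : E) : distSq a x = T.weighted 1 (x - a) (x - a) := by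
  rw [T.weighted_apply, one_mul, T.tr_star_mul_self, distSq]

include T in
lemma TraceForm.contDiff_distSq (a : E) : ContDiff ℝ ∞ (distSq a) := by
  rw [show distSq a = fun x => T.weighted 1 (x - a) (x - a) from funext (T.distSq_eq a)]
  fun_prop

namespace UnitarySlice

variable {S : UnitarySlice E} {a p : E}

omit [StarRing E] [StarModule ℝ E] [FiniteDimensional ℝ E] in
lemma isSmoothOnSubmanifold (f : E → ℝ) (hf : ContDiff ℝ ∞ f) (M : Set E) :
    IsSmoothOnSubmanifold M f :=
  fun _ _ c => hf.comp_contDiffOn c.contDiffOn_param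

include T in
lemma fderiv_distSq_comp_param {d : ℕ} (c : LocalCoordinates S.carrier p d)
    (u : EuclideanSpace ℝ (Fin d)) :
    fderiv ℝ (distSq a ∘ c.param) 0 u = -2 * T.tr (star a * fderiv ℝ c.param 0 u) := by
  have h1 := c.hasFDerivAt_param.bilin_sub_self (T.weighted 1) (T.weighted_symm (star_one E)) a
  rw [show (fun v => T.weighted 1 (c.param v - a) (c.param v - a)) = distSq a ∘ c.param from
      funext fun v => (T.distSq_eq a _).symm] at h1
  have h2 : fderiv ℝ c.param 0 u ∈ S.tangent p := by
    rw [← range_fderiv_param c]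
    exact ⟨u, rfl⟩
  set h := fderiv ℝ c.param 0 u
  have h3 : T.tr (star p * h) = 0 := by
    have e1 := congrArg T.tr h2.2
    have e2 := T.tr_star (star p * h)
    rw [star_mul, star_star] at e2
    rw [map_add, map_zero] at e1
    linarith
  rw [h1.fderiv]
  simp only [c.param_zero, smul_apply, ContinuousLinearMap.comp_apply, T.weighted_apply]
  simp only [one_mul, star_sub, sub_mul, map_sub, smul_eq_mul]
  rw [h3]
  ring

include T in
/-- The critical points are the points `p` at which `p* a` is self-adjoint: the orthogonal
projection of `a` to the tangent space at `p` is `(a - p a* p) / 2`. -/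
lemma mem_criticalSet_iff (ha : a ∈ S.space) :
    p ∈ criticalSet S.carrier (distSq a) ↔ p ∈ S.carrier ∧ star p * a = star a * p := by
  have key : ∀ {d : ℕ} (c : LocalCoordinates S.carrier p d),
      fderiv ℝ (distSq a ∘ c.param) 0 = 0 ↔ star p * a = star a * p := by
    intro d c
    obtain ⟨hpV, -, hpp⟩ := c.mem
    have hpp' := mul_star_self_of_star_mul_self hpp
    have h1 : fderiv ℝ (distSq a ∘ c.param) 0 = 0 ↔ ∀ h ∈ S.tangent p, T.tr (star a * h) = 0 := by
      constructor
      · intro h0 h hh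
        rw [← range_fderiv_param c] at hh
        obtain ⟨u, rfl⟩ := hh
        have := fderiv_distSq_comp_param (a := a) T c u
        rw [h0, zero_apply] at this
        simp only [ContinuousLinearMap.coe_coe] at this ⊢
        linarith
      · intro h0
        ext u
        rw [fderiv_distSq_comp_param T c u, h0 _ (by rw [← range_fderiv_param c]; exact ⟨u, rfl⟩)]
        simp
    rw [h1]
    constructor
    · intro h0
      have e : star p * (p * star a * p) = star a * p := by
        rw [← mul_assoc, ← mul_assoc, hpp, one_mul]
      have e' : star (p * star a * p) * p = star p * a := by
        rw [star_mul, star_mul, star_star, mul_assoc, mul_assoc, hpp, mul_one]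
      have hmem : a - p * star a * p ∈ S.tangent p := by
        refine ⟨sub_mem ha (S.sandwich_mem hpV ha), ?_⟩
        rw [star_sub, mul_sub, sub_mul, e, e']
        abel
      -- The test vector is a multiple of the projection of `a`, so that it is orthogonal to `a`
      -- only if it vanishes.
      have h2 := h0 _ hmem
      have h3 : ‖a - p * star a * p‖ ^ 2 = 2 * T.tr (star a * (a - p * star a * p)) := by
        rw [← T.tr_star_mul_self, star_sub, sub_mul, map_sub, two_mul, sub_eq_add_neg]
        congr 1
        rw [mul_sub, map_sub, mul_sub, map_sub]
        have e1 : T.tr (star (p * star a * p) * a) = T.tr (star a * (p * star a * p)) := by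
          rw [← T.tr_star, star_mul, star_star]
        have e2 : star (p * star a * p) * (p * star a * p) = star p * (a * star a) * p := by
          rw [star_mul, star_mul, star_star]
          calc star p * (a * star p) * (p * star a * p)
              = star p * a * (star p * p) * star a * p := by noncomm_ring
            _ = _ := by rw [hpp]; noncomm_ring
        have e3 : T.tr (star p * (a * star a) * p) = T.tr (star a * a) := by
          rw [T.tr_mul_comm, ← mul_assoc, hpp', one_mul, T.tr_mul_comm]
        rw [e1, e2, e3]
        ring
      rw [h2, mul_zero] at h3
      have h4 : a = p * star a * p :=
        sub_eq_zero.1 (norm_eq_zero.1 (pow_eq_zero_iff two_ne_zero |>.1 h3))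
      rw [← e, ← h4]
    · intro hc h hh
      have e0 : star p * h = -(star h * p) := eq_neg_of_add_eq_zero_left hh.2
      have e1 : T.tr (star a * h) = - T.tr (star h * a) := by
        calc T.tr (star a * h) = T.tr (star a * (p * star p) * h) := by rw [hpp', mul_one]
          _ = T.tr (star p * a * (star p * h)) := by rw [hc]; simp only [mul_assoc]
          _ = - T.tr (star p * (a * (star h * p))) := by rw [e0, mul_neg, map_neg, mul_assoc]
          _ = - T.tr (a * star h) := by
            rw [T.tr_mul_comm, mul_assoc, mul_assoc, hpp', mul_one]
          _ = - T.tr (star h * a) := by rw [T.tr_mul_comm]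
      have e2 := T.tr_star (star a * h)
      rw [star_mul, star_star] at e2
      linarith
  constructor
  · rintro ⟨d, c, hc⟩
    exact ⟨c.mem, (key c).1 hc⟩
  · rintro ⟨hp, hc⟩
    obtain ⟨c⟩ := nonempty_localCoordinates hp
    exact ⟨_, c, (key c).2 hc⟩

/-- On the slice the distance function is a quadratic polynomial without linear term around each
critical point. -/
lemma distSq_eq_add_weighted {x : E} (hp : star p * p = 1) (hx : star x * x = 1)
    (hc : star p * a = star a * p) :
    distSq a x = distSq a p + T.weighted (star p * a) (x - p) (x - p) := by
  have hp' := mul_star_self_of_star_mul_self hp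
  have e1 : T.tr (star p * a * star p * x) = T.tr (star a * x) := by
    rw [hc, mul_assoc (star a), hp', mul_one]
  have e2 : T.tr (star p * a * star x * p) = T.tr (star a * x) := by
    rw [T.tr_mul_comm]
    simp only [← mul_assoc]
    rw [hp', one_mul, ← T.tr_star, star_mul, star_star, T.tr_mul_comm]
  have e3 : T.tr (star x * a) = T.tr (star a * x) := by
    rw [← T.tr_star, star_mul, star_star]
  have e4 : T.tr (star p * a * star p * p) = T.tr (star p * a) := by
    rw [mul_assoc, hp, mul_one]
  have e5 : T.tr (star p * a * star x * x) = T.tr (star p * a) := by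
    rw [mul_assoc, hx, mul_one]
  rw [T.distSq_eq, T.distSq_eq]
  simp only [T.weighted_apply]
  simp only [star_sub, mul_sub, sub_mul, map_sub, one_mul]
  rw [e1, e2, e3, e4, e5, hx, hp, ← hc]
  ring

include T in
/-- In any local coordinates the Hessian at a critical point `p` is twice the pullback of the form
`(h, k) ↦ tr (p* a h* k)` on the tangent space. -/
lemma hessian_apply (hc : star p * a = star a * p) {d : ℕ} (c : LocalCoordinates S.carrier p d)
    (u v : EuclideanSpace ℝ (Fin d)) :
    hessian (distSq a) c u v =
      2 * T.weighted (star p * a) (fderiv ℝ c.param 0 u) (fderiv ℝ c.param 0 v) := by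
  have hbs : star (star p * a) = star p * a := by rw [star_mul, star_star, hc]
  have h1 : ∀ u ∈ c.source, fderiv ℝ (distSq a ∘ c.param) u =
      (2 : ℝ) • (T.weighted (star p * a) (c.param u - p)).comp (fderiv ℝ c.param u) := by
    intro u hu
    have hu' := c.isOpen_source.mem_nhds hu
    have h2 : HasFDerivAt c.param (fderiv ℝ c.param u) u :=
      ((c.contDiffOn_param.contDiffAt hu').differentiableAt (by simp)).hasFDerivAt
    have h3 := (h2.bilin_sub_self (T.weighted (star p * a))
      (T.weighted_symm hbs) p).const_add (distSq a p)
    refine (h3.congr_of_eventuallyEq ?_).fderiv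
    filter_upwards [hu'] with v hv
    exact distSq_eq_add_weighted T c.mem.2.2 (c.mapsTo_param hv).1.2.2 hc
  have h4 : HasFDerivAt (fderiv ℝ c.param) (fderiv ℝ (fderiv ℝ c.param) 0) 0 := by
    have := c.contDiffAt_param.fderiv_right (m := 1) (n := ∞)
      (by rw [← WithTop.coe_one, ← WithTop.coe_add, WithTop.coe_le_coe]; exact le_top)
    exact (this.differentiableAt (by simp)).hasFDerivAt
  have h5 := (((T.weighted (star p * a)).hasFDerivAt.comp 0
    (c.hasFDerivAt_param.sub_const p)).clm_comp h4).const_smul (2 : ℝ)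
  have h6 : HasFDerivAt (fderiv ℝ (distSq a ∘ c.param)) _ 0 :=
    h5.congr_of_eventuallyEq (by filter_upwards [c.source_mem_nhds] with v hv using h1 v hv)
  have h7 : hessian (distSq a) c u v = fderiv ℝ (fderiv ℝ (distSq a ∘ c.param)) 0 u v := rfl
  rw [h7, h6.fderiv]
  simp [c.param_zero]

include T in
/-- A splitting of the tangent space at a critical point into a negative definite and a positive
definite part determines the index. -/
lemma nondegenerate_and_sigNeg (hc : star p * a = star a * p) {d : ℕ}
    (c : LocalCoordinates S.carrier p d) (N P : Submodule ℝ E) (hdisj : Disjoint N P)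
    (hsup : N ⊔ P = S.tangent p)
    (hN : ∀ h ∈ N, h ≠ 0 → T.weighted (star p * a) h h < 0)
    (hP : ∀ h ∈ P, h ≠ 0 → 0 < T.weighted (star p * a) h h) :
    (hessian (distSq a) c).Nondegenerate ∧
      sigNeg (hessian (distSq a) c).toQuadraticMap = Module.finrank ℝ N := by
  have hbs : star (star p * a) = star p * a := by rw [star_mul, star_star, hc]
  let φ : EuclideanSpace ℝ (Fin d) →ₗ[ℝ] E := (fderiv ℝ c.param 0 : _ →ₗ[ℝ] E)
  have hφ : Function.Injective φ := c.fderiv_param_injective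
  have hr : LinearMap.range φ = N ⊔ P := by rw [hsup]; exact range_fderiv_param c
  have hcompl : IsCompl (N.comap φ) (P.comap φ) := by
    constructor
    · rw [Submodule.disjoint_def] at hdisj ⊢
      intro x hx hx'
      exact hφ (by rw [hdisj _ hx hx', map_zero])
    · rw [codisjoint_iff, eq_top_iff]
      rintro x -
      have : φ x ∈ N ⊔ P := by rw [← hr]; exact ⟨x, rfl⟩
      obtain ⟨y, hy, z, hz, hyz⟩ := Submodule.mem_sup.1 this
      obtain ⟨y', rfl⟩ : y ∈ LinearMap.range φ := by rw [hr]; exact Submodule.mem_sup_left hy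
      obtain ⟨z', rfl⟩ : z ∈ LinearMap.range φ := by rw [hr]; exact Submodule.mem_sup_right hz
      rw [← map_add] at hyz
      rw [← hφ hyz]
      exact Submodule.add_mem_sup hy hz
  have hfin : Module.finrank ℝ (N.comap φ) = Module.finrank ℝ N := by
    rw [(Submodule.equivMapOfInjective φ hφ _).finrank_eq,
      Submodule.map_comap_eq_self (by rw [hr]; exact le_sup_left)]
  rw [← hfin]
  refine nondegenerate_and_sigNeg_of_isCompl _ (fun u v => ?_) _ _ hcompl ?_ ?_
  · rw [hessian_apply T hc, hessian_apply T hc, T.weighted_symm hbs]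
  · intro u hu hu0
    rw [hessian_apply T hc]
    have := hN (φ u) hu (fun h => hu0 (hφ (by rw [h, map_zero])))
    change T.weighted (star p * a) (fderiv ℝ c.param 0 u) (fderiv ℝ c.param 0 u) < 0 at this
    linarith
  · intro u hu hu0
    rw [hessian_apply T hc]
    have := hP (φ u) hu (fun h => hu0 (hφ (by rw [h, map_zero])))
    change 0 < T.weighted (star p * a) (fderiv ℝ c.param 0 u) (fderiv ℝ c.param 0 u) at this
    linarith

end UnitarySlice
end

/-! ### Projections to tangent spaces, and matrices with the Frobenius norm -/

section TangentProjection

variable {E : Type*} [NormedRing E] [NormedAlgebra ℝ E] [StarRing E] [StarModule ℝ E]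
  [FiniteDimensional ℝ E] {S : UnitarySlice E} {p : E}

/-- The map `h ↦ p h* p`, an involution when `p` is unitary. -/
noncomputable def sandwich (p : E) : E →ₗ[ℝ] E :=
  LinearMap.mulRight ℝ p ∘ₗ LinearMap.mulLeft ℝ p ∘ₗ (starCLM E : E →ₗ[ℝ] E)

@[simp] lemma sandwich_apply (p h : E) : sandwich p h = p * star h * p := rfl

namespace UnitarySlice

/-- A projection onto the space of the slice yields one onto the tangent space at `p`, the
`-1`-eigenspace of `h ↦ p h* p` in the space of the slice. -/
lemma isProj_tangent (hp : p ∈ S.carrier) {π : E →ₗ[ℝ] E} (hπ : LinearMap.IsProj S.space π) :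
    LinearMap.IsProj (S.tangent p) ((1 / 2 : ℝ) • (π - sandwich p ∘ₗ π)) := by
  obtain ⟨hpV, -, hpp⟩ := hp
  have hpp' := mul_star_self_of_star_mul_self hpp
  constructor
  · intro h
    have hv := hπ.map_mem h
    refine Submodule.smul_mem _ _ ⟨sub_mem hv (S.sandwich_mem hpV hv), ?_⟩
    simp only [LinearMap.sub_apply, LinearMap.comp_apply, sandwich_apply, star_sub, star_mul,
      star_star, mul_sub, sub_mul]
    rw [← mul_assoc (star p), ← mul_assoc (star p), hpp, mul_assoc (star p) _ p,
      mul_assoc _ (star p) p, hpp, one_mul, mul_one]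
    abel
  · rintro h ⟨hV, ht⟩
    have h1 : p * star h * p = -h := by
      rw [mul_assoc, ← neg_eq_of_add_eq_zero_right ht, mul_neg, ← mul_assoc, hpp', one_mul]
    simp only [LinearMap.smul_apply, LinearMap.sub_apply, LinearMap.comp_apply, sandwich_apply,
      hπ.map_id h hV, h1, sub_neg_eq_add, ← two_smul ℝ h, smul_smul]
    norm_num

end UnitarySlice

end TangentProjection

namespace Matrix

variable {κ : Type*} [Fintype κ] [DecidableEq κ]

lemma trace_linearMap_eq_sum {𝔽 : Type*} [AddCommGroup 𝔽] [Module ℝ 𝔽] [FiniteDimensional ℝ 𝔽]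
    (L : Matrix κ κ 𝔽 →ₗ[ℝ] Matrix κ κ 𝔽) :
    LinearMap.trace ℝ _ L = ∑ x, ∑ y, LinearMap.trace ℝ 𝔽
      (entryLinearMap ℝ 𝔽 x y ∘ₗ L ∘ₗ singleLinearMap ℝ x y) := by
  have h : L = ∑ x, ∑ y, (L ∘ₗ singleLinearMap ℝ x y) ∘ₗ entryLinearMap ℝ 𝔽 x y := by
    ext1 h
    simp only [LinearMap.sum_apply, LinearMap.comp_apply, entryLinearMap_apply,
      singleLinearMap_apply, ← map_sum]
    rw [← matrix_eq_sum_single]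
  conv_lhs => rw [h]
  simp only [map_sum]
  refine Finset.sum_congr rfl fun x _ => Finset.sum_congr rfl fun y _ => ?_
  exact LinearMap.trace_comp_comm' _ _

section FrobeniusRing

variable {𝔽 : Type*} [NormedRing 𝔽]

omit [DecidableEq κ] in
lemma frobenius_norm_sq (A : Matrix κ κ 𝔽) : ‖A‖ ^ 2 = ∑ x, ∑ y, ‖A x y‖ ^ 2 := by
  rw [frobenius_norm_def, ← Real.sqrt_eq_rpow, Real.sq_sqrt (by positivity)]
  simp

omit [DecidableEq κ] in
lemma frobenius_norm_mul_le (A B : Matrix κ κ 𝔽) : ‖A * B‖ ≤ ‖A‖ * ‖B‖ := by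
  have h1 : ∀ A : Matrix κ κ 𝔽, ‖A.map norm‖ = ‖A‖ := fun A =>
    frobenius_norm_map_eq A norm fun a => norm_norm a
  rw [← h1 A, ← h1 B]
  refine le_trans ?_ (frobenius_norm_mul (A.map norm) (B.map norm))
  refine abs_le_of_sq_le_sq' ?_ (norm_nonneg _) |>.2
  rw [frobenius_norm_sq, frobenius_norm_sq]
  gcongr with x _ y _
  rw [mul_apply, mul_apply, Real.norm_of_nonneg (by simp; positivity)]
  refine (norm_sum_le _ _).trans ?_
  gcongr with z
  exact norm_mul_le _ _

/-- The Frobenius norm makes the square matrices over any normed ring a normed ring. -/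
@[reducible] noncomputable def frobeniusNormedRingOfNormedRing : NormedRing (Matrix κ κ 𝔽) :=
  { Matrix.frobeniusNormedAddCommGroup, Matrix.instRing with
    norm_mul_le := frobenius_norm_mul_le }

attribute [local instance] frobeniusNormedRingOfNormedRing

/-- The normed algebra structure belonging to `frobeniusNormedRingOfNormedRing`. -/
@[reducible] noncomputable def frobeniusNormedAlgebraOfNormedRing [NormedAlgebra ℝ 𝔽] :
    NormedAlgebra ℝ (Matrix κ κ 𝔽) :=
  { Matrix.frobeniusNormedSpace, Matrix.instAlgebra with }

attribute [local instance] frobeniusNormedAlgebraOfNormedRing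

variable [NormedAlgebra ℝ 𝔽] [StarRing 𝔽]

variable (κ) in
/-- The sum of the diagonal entries, followed by the trace form of the coefficients. -/
noncomputable def _root_.TraceForm.matrix (T : TraceForm 𝔽) : TraceForm (Matrix κ κ 𝔽) where
  tr := T.tr ∘ₗ Matrix.traceLinearMap κ ℝ 𝔽
  tr_mul_comm x y := by
    simp only [LinearMap.comp_apply, traceLinearMap_apply, trace, diag_apply, mul_apply, map_sum]
    rw [Finset.sum_comm]
    simp only [T.tr_mul_comm (x _ _)]
  tr_star x := by
    simp [trace, star_apply, T.tr_star]
  tr_star_mul_self x := by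
    rw [frobenius_norm_sq, Finset.sum_comm]
    simp [trace, mul_apply, star_apply, T.tr_star_mul_self]

@[simp] lemma _root_.TraceForm.matrix_apply (T : TraceForm 𝔽) (x : Matrix κ κ 𝔽) :
    (T.matrix κ).tr x = ∑ i, T.tr (x i i) := by
  simp [TraceForm.matrix, trace]

end FrobeniusRing

end Matrix

/-! ### The Hessian form on matrices -/

lemma signs_mul_add_neg {n : ℕ} {lam : Fin n → ℝ} (hpos : ∀ i, 0 < lam i) (hmono : StrictMono lam)
    {I : Finset (Fin n)} {i j : Fin n} (h : max i j ∈ I) :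
    signs I i * lam i + signs I j * lam j < 0 := by
  wlog hij : i ≤ j generalizing i j
  · rw [add_comm]
    exact this (by rwa [max_comm]) (le_of_not_ge hij)
  rw [max_eq_right hij] at h
  have h1 := hpos i
  have h2 := hpos j
  rcases hij.eq_or_lt with rfl | hlt
  · simp only [signs, h, if_true]; linarith
  · have := hmono hlt
    simp only [signs, h, if_true]
    split_ifs <;> linarith

lemma signs_mul_add_pos {n : ℕ} {lam : Fin n → ℝ} (hpos : ∀ i, 0 < lam i) (hmono : StrictMono lam)
    {I : Finset (Fin n)} {i j : Fin n} (h : max i j ∉ I) :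
    0 < signs I i * lam i + signs I j * lam j := by
  wlog hij : i ≤ j generalizing i j
  · rw [add_comm]
    exact this (by rwa [max_comm]) (le_of_not_ge hij)
  rw [max_eq_right hij] at h
  have h1 := hpos i
  have h2 := hpos j
  rcases hij.eq_or_lt with rfl | hlt
  · simp only [signs, h, if_false]; linarith
  · have := hmono hlt
    simp only [signs, h, if_false]
    split_ifs <;> linarith

namespace Matrix

attribute [local instance] frobeniusNormedRingOfNormedRing frobeniusNormedAlgebraOfNormedRing

variable {κ : Type*} [Fintype κ] [DecidableEq κ] {n : ℕ} {𝔽 : Type*} [NormedRing 𝔽]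
  [NormedAlgebra ℝ 𝔽]

/-- The linear map that keeps the entries of a matrix in those positions `(x, y)` for which the
larger one of the block numbers `g x` and `g y` lies in `I`, and makes the others zero. -/
def maskEntries (𝔽 : Type*) [NormedRing 𝔽] [NormedAlgebra ℝ 𝔽] (g : κ → Fin n)
    (I : Finset (Fin n)) : Matrix κ κ 𝔽 →ₗ[ℝ] Matrix κ κ 𝔽 where
  toFun h := of fun x y => if max (g x) (g y) ∈ I then h x y else 0
  map_add' h k := by ext x y; simp only [of_apply, add_apply]; split_ifs <;> simp
  map_smul' r h := by ext x y; simp [of_apply, smul_apply]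

omit [Fintype κ] [DecidableEq κ] in
@[simp] lemma maskEntries_apply (g : κ → Fin n) (I : Finset (Fin n)) (h : Matrix κ κ 𝔽) (x y : κ) :
    maskEntries 𝔽 g I h x y = if max (g x) (g y) ∈ I then h x y else 0 := rfl

variable [StarRing 𝔽] [StarModule ℝ 𝔽] [FiniteDimensional ℝ 𝔽]

/-- For a matrix with `‖h_xy‖ = ‖h_yx‖`, the sum `∑ μ_y ‖h_xy‖²` may be symmetrized in `x`, `y`. -/
lemma two_mul_weighted_diagonal (T : TraceForm 𝔽) (μ : κ → ℝ) {h : Matrix κ κ 𝔽}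
    (hsym : ∀ x y, ‖h x y‖ = ‖h y x‖) :
    2 * (T.matrix κ).weighted (diagonal fun x => algebraMap ℝ 𝔽 (μ x)) h h =
      ∑ x, ∑ y, (μ x + μ y) * ‖h x y‖ ^ 2 := by
  have h1 : (T.matrix κ).weighted (diagonal fun x => algebraMap ℝ 𝔽 (μ x)) h h =
      ∑ x, ∑ y, μ x * ‖h x y‖ ^ 2 := by
    have e : ∀ x, ((diagonal fun x => algebraMap ℝ 𝔽 (μ x)) * star h * h) x x =
        ∑ y, μ x • (star (h y x) * h y x) := by
      intro x
      rw [Matrix.mul_assoc, diagonal_mul, mul_apply, ← Algebra.smul_def, Finset.smul_sum]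
      rfl
    rw [TraceForm.weighted_apply, TraceForm.matrix_apply]
    change ∑ x, T.tr (((diagonal fun x => algebraMap ℝ 𝔽 (μ x)) * star h * h) x x) = _
    refine Finset.sum_congr rfl fun x _ => ?_
    rw [e, map_sum]
    refine Finset.sum_congr rfl fun y _ => ?_
    rw [map_smul, T.tr_star_mul_self, smul_eq_mul, hsym]
  have h2 : ∑ x, ∑ y, μ x * ‖h x y‖ ^ 2 = ∑ x, ∑ y, μ y * ‖h x y‖ ^ 2 := by
    rw [Finset.sum_comm]
    simp only [hsym]
  simp only [add_mul, Finset.sum_add_distrib]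
  rw [← h2, h1, two_mul]

/-- The index at the critical point with signs `I`: the Hessian form is
`∑ (ε_x λ_x + ε_y λ_y) |h_xy|²`, in which `λ_(max (x, y))` dominates, so that the negative part
consists of the matrices supported in the positions with `max (x, y) ∈ I`. -/
lemma nondegenerate_and_sigNeg (T : TraceForm 𝔽) {S : UnitarySlice (Matrix κ κ 𝔽)}
    {a p : Matrix κ κ 𝔽} {π : Matrix κ κ 𝔽 →ₗ[ℝ] Matrix κ κ 𝔽}
    {lam : Fin n → ℝ} (hpos : ∀ i, 0 < lam i) (hmono : StrictMono lam)
    (g : κ → Fin n) (I : Finset (Fin n))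
    (hb : star p * a = diagonal fun x => algebraMap ℝ 𝔽 (signs I (g x) * lam (g x)))
    (hsym : ∀ h ∈ S.tangent p, ∀ x y, ‖h x y‖ = ‖h y x‖)
    (hπ : LinearMap.IsProj (S.tangent p) π)
    (hmask : ∀ h, maskEntries 𝔽 g I (π h) = π (maskEntries 𝔽 g I h))
    {d : ℕ} (c : LocalCoordinates S.carrier p d) :
    (hessian (distSq a) c).Nondegenerate ∧
      (sigNeg (hessian (distSq a) c).toQuadraticMap : ℝ) =
        LinearMap.trace ℝ _ (maskEntries 𝔽 g I ∘ₗ π) := by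
  set m := maskEntries 𝔽 g I with hm
  have hmm : ∀ h, m (m h) = m h := by
    intro h; ext x y; simp only [hm, maskEntries_apply]; split_ifs <;> rfl
  have hmT : ∀ h ∈ S.tangent p, m h ∈ S.tangent p := by
    intro h hh
    rw [← hπ.map_id h hh, hmask]
    exact hπ.map_mem _
  have hc : star p * a = star a * p := by
    have : star (star p * a) = star p * a := by
      rw [hb, star_eq_conjTranspose, diagonal_conjTranspose]
      congr 1
      ext x
      simp only [Pi.star_apply, Algebra.algebraMap_eq_smul_one, star_smul, star_one, star_trivial]
    rw [← this, star_mul, star_star]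
  let N := S.tangent p ⊓ LinearMap.eqLocus m LinearMap.id
  let P := S.tangent p ⊓ LinearMap.ker m
  have hproj : LinearMap.IsProj N (m ∘ₗ π) := by
    constructor
    · intro h
      exact ⟨hmT _ (hπ.map_mem h), hmm _⟩
    · rintro h ⟨hT, hh⟩
      rw [LinearMap.comp_apply, hπ.map_id h hT]
      exact hh
  have hsq : ∀ h : Matrix κ κ 𝔽, h ≠ 0 → ∃ x y, 0 < ‖h x y‖ ^ 2 := by
    intro h h0
    by_contra! hcon
    refine h0 (ext fun x y => ?_)
    have := le_antisymm (hcon x y) (by positivity)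
    simpa using this
  have hmain := UnitarySlice.nondegenerate_and_sigNeg (T.matrix κ) hc c N P ?_ ?_ ?_ ?_
  · refine ⟨hmain.1, ?_⟩
    rw [hmain.2, hproj.trace]
  · rw [Submodule.disjoint_def]
    rintro h ⟨-, h1⟩ ⟨-, h2⟩
    have h1' : m h = h := h1
    rw [← h1']; exact h2
  · refine le_antisymm (sup_le inf_le_left inf_le_left) fun h hh => ?_
    rw [← add_sub_cancel (m h) h]
    refine Submodule.add_mem_sup ⟨hmT h hh, hmm h⟩ ⟨sub_mem hh (hmT h hh), ?_⟩
    exact LinearMap.mem_ker.2 (by rw [map_sub, hmm, sub_self])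
  · rintro h ⟨hT, hh⟩ h0
    have hh' : m h = h := hh
    have h1 := two_mul_weighted_diagonal T (fun x => signs I (g x) * lam (g x)) (hsym h hT)
    rw [← hb] at h1
    have h2 : ∀ x y, (signs I (g x) * lam (g x) + signs I (g y) * lam (g y)) * ‖h x y‖ ^ 2 ≤ 0 := by
      intro x y
      by_cases hxy : max (g x) (g y) ∈ I
      · exact mul_nonpos_of_nonpos_of_nonneg (signs_mul_add_neg hpos hmono hxy).le (by positivity)
      · rw [← hh', hm, maskEntries_apply, if_neg hxy]; simp
    obtain ⟨x, y, hxy⟩ := hsq h h0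
    have hmem : max (g x) (g y) ∈ I := by
      by_contra hcon
      rw [← hh', hm, maskEntries_apply, if_neg hcon] at hxy
      simp at hxy
    have h3 : ∑ x, ∑ y, (signs I (g x) * lam (g x) + signs I (g y) * lam (g y)) * ‖h x y‖ ^ 2 < 0 :=
      Finset.sum_neg' (fun x _ => Finset.sum_nonpos fun y _ => h2 x y) ⟨x, Finset.mem_univ _,
        Finset.sum_neg' (fun y _ => h2 x y) ⟨y, Finset.mem_univ _,
          mul_neg_of_neg_of_pos (signs_mul_add_neg hpos hmono hmem) hxy⟩⟩
    linarith
  · rintro h ⟨hT, hh⟩ h0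
    have hh' : m h = 0 := hh
    have hz : ∀ x y, max (g x) (g y) ∈ I → h x y = 0 := by
      intro x y hxy
      have := congrFun (congrFun hh' x) y
      rwa [hm, maskEntries_apply, if_pos hxy] at this
    have h1 := two_mul_weighted_diagonal T (fun x => signs I (g x) * lam (g x)) (hsym h hT)
    rw [← hb] at h1
    have h2 : ∀ x y, 0 ≤ (signs I (g x) * lam (g x) + signs I (g y) * lam (g y)) * ‖h x y‖ ^ 2 := by
      intro x y
      by_cases hxy : max (g x) (g y) ∈ I
      · simp [hz x y hxy]
      · exact mul_nonneg (signs_mul_add_pos hpos hmono hxy).le (by positivity)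
    obtain ⟨x, y, hxy⟩ := hsq h h0
    have hmem : max (g x) (g y) ∉ I := by
      intro hcon
      simp [hz x y hcon] at hxy
    have h3 : 0 < ∑ x, ∑ y, (signs I (g x) * lam (g x) + signs I (g y) * lam (g y)) * ‖h x y‖ ^ 2 :=
      Finset.sum_pos' (fun x _ => Finset.sum_nonneg fun y _ => h2 x y) ⟨x, Finset.mem_univ _,
        Finset.sum_pos' (fun y _ => h2 x y) ⟨y, Finset.mem_univ _,
          mul_pos (signs_mul_add_pos hpos hmono hmem) hxy⟩⟩
    linarith

end Matrix

/-! ### Morse functions on slices of matrices -/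

namespace UnitarySlice

variable {E : Type*} [NormedRing E] [NormedAlgebra ℝ E] [StarRing E] [StarModule ℝ E]
  [FiniteDimensional ℝ E] {S : UnitarySlice E} {p : E}

lemma sandwich_eq_neg {h : E} (hp : p ∈ S.carrier) (hh : h ∈ S.tangent p) : sandwich p h = -h := by
  rw [sandwich_apply, mul_assoc, ← neg_eq_of_add_eq_zero_right hh.2, mul_neg, ← mul_assoc,
    mul_star_self_of_star_mul_self hp.2.2, one_mul]

/-- The Morse property, the critical set and the indices, from the critical points `σ i` with `s i`,
and the signature of the Hessian form at each of them. -/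
lemma isMorseFunction_and_criticalSet (T : TraceForm E) {a : E} (ha : a ∈ S.space) {ι : Type*}
    (s : ι → Prop) (σ : ι → E) (r : ι → ℤ)
    (hdim : ∀ p ∈ S.carrier, ∀ q ∈ S.carrier,
      Module.finrank ℝ (S.tangent p) = Module.finrank ℝ (S.tangent q))
    (hcrit : ∀ p ∈ S.carrier, star p * a = star a * p → ∃ i, s i ∧ p = σ i)
    (hσ : ∀ i, s i → σ i ∈ S.carrier ∧ star (σ i) * a = star a * σ i)
    (hind : ∀ i, s i → ∀ (d : ℕ) (c : LocalCoordinates S.carrier (σ i) d),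
      (hessian (distSq a) c).Nondegenerate ∧
        (sigNeg (hessian (distSq a) c).toQuadraticMap : ℤ) = r i) :
    IsMorseFunction S.carrier (distSq a) ∧
      criticalSet S.carrier (distSq a) = {x | ∃ i, s i ∧ x = σ i} ∧
      ∀ i, s i → HasMorseIndex S.carrier (distSq a) (σ i) (r i) := by
  have hset : criticalSet S.carrier (distSq a) = {x | ∃ i, s i ∧ x = σ i} := by
    ext p
    rw [mem_criticalSet_iff T ha]
    constructor
    · rintro ⟨hp, hc⟩
      exact hcrit p hp hc
    · rintro ⟨i, hi, rfl⟩
      exact hσ i hi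
  refine ⟨⟨?_, isSmoothOnSubmanifold _ (T.contDiff_distSq a) _, ?_⟩, hset, ?_⟩
  · rcases S.carrier.eq_empty_or_nonempty with h | ⟨q, hq⟩
    · exact ⟨0, fun p hp => by simp [h] at hp⟩
    · exact ⟨_, isSmoothSubmanifold fun p hp => hdim p hp q hq⟩
  · intro p hp d c
    rw [hset] at hp
    obtain ⟨i, hi, rfl⟩ := hp
    exact (hind i hi d c).1
  · intro i hi
    exact ⟨by rw [hset]; exact ⟨i, hi, rfl⟩, hind i hi⟩

end UnitarySlice

namespace Matrix

attribute [local instance] frobeniusNormedRingOfNormedRing frobeniusNormedAlgebraOfNormedRing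

section Mask

variable {κ : Type*} [Fintype κ] [DecidableEq κ] {n : ℕ} {𝔽 : Type*} [NormedRing 𝔽]
  [NormedAlgebra ℝ 𝔽]

/-- The contribution of the entry in position `(x, y)` to the trace of a linear map. -/
noncomputable def entryTrace (L : Matrix κ κ 𝔽 →ₗ[ℝ] Matrix κ κ 𝔽) (x y : κ) : ℝ :=
  LinearMap.trace ℝ 𝔽 (entryLinearMap ℝ 𝔽 x y ∘ₗ L ∘ₗ singleLinearMap ℝ x y)

lemma trace_eq_sum_entryTrace [FiniteDimensional ℝ 𝔽] (L : Matrix κ κ 𝔽 →ₗ[ℝ] Matrix κ κ 𝔽) :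
    LinearMap.trace ℝ _ L = ∑ x, ∑ y, entryTrace L x y := trace_linearMap_eq_sum L

lemma trace_maskEntries_comp [FiniteDimensional ℝ 𝔽] (g : κ → Fin n) (I : Finset (Fin n))
    (L : Matrix κ κ 𝔽 →ₗ[ℝ] Matrix κ κ 𝔽) :
    LinearMap.trace ℝ _ (maskEntries 𝔽 g I ∘ₗ L) =
      ∑ x, ∑ y, if max (g x) (g y) ∈ I then entryTrace L x y else 0 := by
  rw [trace_linearMap_eq_sum]
  refine Finset.sum_congr rfl fun x _ => Finset.sum_congr rfl fun y _ => ?_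
  split_ifs with h
  · rw [entryTrace]
    congr 1
    ext z
    simp [h]
  · rw [← map_zero (LinearMap.trace ℝ 𝔽)]
    congr 1
    ext z
    simp [h]

omit [Fintype κ] in
lemma entryTrace_smul (r : ℝ) (L : Matrix κ κ 𝔽 →ₗ[ℝ] Matrix κ κ 𝔽) (x y : κ) :
    entryTrace (r • L) x y = r * entryTrace L x y := by
  rw [entryTrace, entryTrace, LinearMap.smul_comp, LinearMap.comp_smul, map_smul, smul_eq_mul]

omit [DecidableEq κ] in
/-- Masking commutes with multiplication by block diagonal matrices. -/
lemma maskEntries_mul_left {g : κ → Fin n} (I : Finset (Fin n)) {p : Matrix κ κ 𝔽}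
    (hp : ∀ x y, g x ≠ g y → p x y = 0) (h : Matrix κ κ 𝔽) :
    maskEntries 𝔽 g I (p * h) = p * maskEntries 𝔽 g I h := by
  ext x y
  have e : ∀ z, p x z * maskEntries 𝔽 g I h z y =
      if max (g x) (g y) ∈ I then p x z * h z y else 0 := by
    intro z
    by_cases hxz : g x = g z
    · rw [maskEntries_apply, hxz, mul_ite, mul_zero]
    · simp [hp x z hxz]
  change (if max (g x) (g y) ∈ I then ∑ z, p x z * h z y else 0) =
    ∑ z, p x z * maskEntries 𝔽 g I h z y
  simp only [e]
  split_ifs <;> simp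

omit [DecidableEq κ] in
lemma maskEntries_mul_right {g : κ → Fin n} (I : Finset (Fin n)) {p : Matrix κ κ 𝔽}
    (hp : ∀ x y, g x ≠ g y → p x y = 0) (h : Matrix κ κ 𝔽) :
    maskEntries 𝔽 g I (h * p) = maskEntries 𝔽 g I h * p := by
  ext x y
  have e : ∀ z, maskEntries 𝔽 g I h x z * p z y =
      if max (g x) (g y) ∈ I then h x z * p z y else 0 := by
    intro z
    by_cases hxz : g z = g y
    · rw [maskEntries_apply, hxz, ite_mul, zero_mul]
    · simp [hp z y hxz]
  change (if max (g x) (g y) ∈ I then ∑ z, h x z * p z y else 0) =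
    ∑ z, maskEntries 𝔽 g I h x z * p z y
  simp only [e]
  split_ifs <;> simp

omit [Fintype κ] [DecidableEq κ] in
lemma maskEntries_star [StarRing 𝔽] {g : κ → Fin n} (I : Finset (Fin n)) (h : Matrix κ κ 𝔽) :
    maskEntries 𝔽 g I (star h) = star (maskEntries 𝔽 g I h) := by
  ext x y
  simp only [maskEntries_apply, star_apply, max_comm (g x)]
  split_ifs <;> simp

omit [Fintype κ] [DecidableEq κ] in
lemma maskEntries_transpose {g : κ → Fin n} (I : Finset (Fin n)) (h : Matrix κ κ 𝔽) :
    maskEntries 𝔽 g I hᵀ = (maskEntries 𝔽 g I h)ᵀ := by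
  ext x y
  simp only [maskEntries_apply, transpose_apply, max_comm (g x)]

omit [NormedAlgebra ℝ 𝔽] in
lemma mul_single_mul_apply (p q : Matrix κ κ 𝔽) (i j x y : κ) (z : 𝔽) :
    (p * single i j z * q) x y = p x i * z * q j y := by
  rw [mul_apply, Finset.sum_eq_single j]
  · rw [mul_single_apply_same]
  · intro b _ hb
    rw [mul_single_apply_of_ne _ _ _ _ _ hb, zero_mul]
  · simp

variable [StarRing 𝔽] [StarModule ℝ 𝔽] [FiniteDimensional ℝ 𝔽]

lemma maskEntries_tangentProj {g : κ → Fin n} (I : Finset (Fin n)) {p : Matrix κ κ 𝔽}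
    (hp : ∀ x y, g x ≠ g y → p x y = 0) {π : Matrix κ κ 𝔽 →ₗ[ℝ] Matrix κ κ 𝔽}
    (hπ : ∀ h, maskEntries 𝔽 g I (π h) = π (maskEntries 𝔽 g I h)) (h : Matrix κ κ 𝔽) :
    maskEntries 𝔽 g I (((1 / 2 : ℝ) • (π - sandwich p ∘ₗ π)) h) =
      ((1 / 2 : ℝ) • (π - sandwich p ∘ₗ π)) (maskEntries 𝔽 g I h) := by
  have h1 : ∀ h, maskEntries 𝔽 g I (sandwich p h) = sandwich p (maskEntries 𝔽 g I h) := by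
    intro h
    rw [sandwich_apply, sandwich_apply, ← maskEntries_star]
    exact (maskEntries_mul_right I hp _).trans
      (congrArg (· * p) (maskEntries_mul_left I hp (star h)))
  rw [LinearMap.smul_apply, LinearMap.smul_apply, map_smul, LinearMap.sub_apply, map_sub,
    LinearMap.sub_apply, LinearMap.comp_apply, LinearMap.comp_apply, h1, hπ]

/-- Two tangent spaces have the same dimension if the projections onto them have the same trace. -/
lemma finrank_tangent_eq {S : UnitarySlice (Matrix κ κ 𝔽)}
    {π : Matrix κ κ 𝔽 →ₗ[ℝ] Matrix κ κ 𝔽} (hπ : LinearMap.IsProj S.space π) {r : ℝ}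
    (h : ∀ p ∈ S.carrier, ∑ x, ∑ y, entryTrace ((1 / 2 : ℝ) • (π - sandwich p ∘ₗ π)) x y = r) :
    ∀ p ∈ S.carrier, ∀ q ∈ S.carrier,
      Module.finrank ℝ (S.tangent p) = Module.finrank ℝ (S.tangent q) := by
  have key : ∀ p ∈ S.carrier, (Module.finrank ℝ (S.tangent p) : ℝ) = r := by
    intro p hp
    rw [← h p hp, ← trace_eq_sum_entryTrace, (UnitarySlice.isProj_tangent hp hπ).trace]
  intro p hp q hq
  have := (key p hp).trans (key q hq).symm
  exact_mod_cast this

end Mask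

section Diagonal

variable {n : ℕ} {𝔽 : Type} [NormedRing 𝔽] [NormedAlgebra ℝ 𝔽]

lemma realDiagonal_apply_eq_zero (v : Fin n → ℝ) {x y : Fin n} (h : x ≠ y) :
    realDiagonal 𝔽 v x y = 0 := diagonal_apply_ne _ h

lemma realDiagonal_mul (v w : Fin n → ℝ) :
    realDiagonal 𝔽 v * realDiagonal 𝔽 w = realDiagonal 𝔽 fun x => v x * w x := by
  simp [realDiagonal]

lemma realDiagonal_one : realDiagonal 𝔽 (fun _ : Fin n => 1) = 1 := by
  simp [realDiagonal]

lemma signs_mul_self (I : Finset (Fin n)) (x : Fin n) : signs I x * signs I x = 1 := by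
  unfold signs; split_ifs <;> norm_num

variable [StarRing 𝔽] [StarModule ℝ 𝔽] [FiniteDimensional ℝ 𝔽]

omit [FiniteDimensional ℝ 𝔽] in
lemma star_realDiagonal (v : Fin n → ℝ) : star (realDiagonal 𝔽 v) = realDiagonal 𝔽 v := by
  rw [realDiagonal, star_eq_conjTranspose, diagonal_conjTranspose]
  congr 1
  ext x
  simp only [Pi.star_apply, Algebra.algebraMap_eq_smul_one, star_smul, star_one, star_trivial]

omit [FiniteDimensional ℝ 𝔽] in
lemma star_realDiagonal_signs_mul_self (I : Finset (Fin n)) :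
    star (realDiagonal 𝔽 (signs I)) * realDiagonal 𝔽 (signs I) = 1 := by
  rw [star_realDiagonal, realDiagonal_mul, ← realDiagonal_one]
  simp only [signs_mul_self]

/-- A unitary matrix `p` for which `p* a` is self-adjoint commutes with `a²`, hence is diagonal with
self-adjoint unitary entries. -/
lemma eq_realDiagonal_signs [NoZeroDivisors 𝔽] {lam : Fin n → ℝ}
    (hpos : ∀ i, 0 < lam i) (hmono : StrictMono lam) {p : Matrix (Fin n) (Fin n) 𝔽}
    (hp : star p * p = 1) (hc : star p * realDiagonal 𝔽 lam = star (realDiagonal 𝔽 lam) * p) :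
    ∃ I : Finset (Fin n), p = realDiagonal 𝔽 (signs I) := by
  classical
  have hp' : p * star p = 1 :=
    mul_star_self_of_star_mul_self (E := Matrix (Fin n) (Fin n) 𝔽) hp
  rw [star_realDiagonal] at hc
  set a := realDiagonal 𝔽 lam with ha
  have h1 : p * a = a * star p := by
    calc p * a = p * a * (p * star p) := by rw [hp', Matrix.mul_one]
      _ = p * (a * p) * star p := by simp only [Matrix.mul_assoc]
      _ = (p * star p) * a * star p := by rw [← hc]; simp only [Matrix.mul_assoc]
      _ = a * star p := by rw [hp', Matrix.one_mul]
  have h2 : p * (a * a) = a * a * p := by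
    rw [← Matrix.mul_assoc, h1, Matrix.mul_assoc, hc, Matrix.mul_assoc]
  have hoff : ∀ x y, x ≠ y → p x y = 0 := by
    intro x y hxy
    have h3 := congrFun (congrFun h2 x) y
    rw [ha, realDiagonal_mul, realDiagonal, mul_diagonal, diagonal_mul, ← Algebra.commutes,
      ← Algebra.smul_def, ← Algebra.smul_def, ← sub_eq_zero, ← sub_smul, smul_eq_zero] at h3
    rcases h3 with h3 | h3
    · refine absurd (hmono.injective ?_) hxy.symm
      have h4 : (lam y - lam x) * (lam y + lam x) = 0 := by linarith
      have := hpos x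
      have := hpos y
      rcases mul_eq_zero.1 h4 with h4 | h4 <;> linarith
    · exact h3
  have hdiag : ∀ x, p x x = 1 ∨ p x x = -1 := by
    intro x
    have h3 := congrFun (congrFun hc x) x
    rw [ha, realDiagonal, mul_diagonal, diagonal_mul, ← Algebra.commutes,
      ← Algebra.smul_def, ← Algebra.smul_def] at h3
    have h4 : star (p x x) = p x x := smul_right_injective _ (hpos x).ne' h3
    have h5 := congrFun (congrFun hp x) x
    rw [mul_apply, Finset.sum_eq_single x (fun y _ hy => by rw [hoff y x hy, mul_zero]) (by simp),
      star_apply, h4, one_apply_eq] at h5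
    exact mul_self_eq_one_iff.1 h5
  refine ⟨Finset.univ.filter fun x => p x x = -1, ?_⟩
  ext x y
  by_cases hxy : x = y
  · subst hxy
    rw [realDiagonal, diagonal_apply_eq, signs]
    by_cases h : p x x = -1
    · simp [h]
    · rw [if_neg (by simpa using h), map_one]
      exact (hdiag x).resolve_right h
  · rw [hoff x y hxy, realDiagonal_apply_eq_zero _ hxy]

/-- The critical points and their indices, for a slice that consists of matrices whose entries
`x_ij` and `x_ji` have the same norm on the tangent spaces. -/
lemma morse_realDiagonal [NoZeroDivisors 𝔽] (T : TraceForm 𝔽) {lam : Fin n → ℝ}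
    (hpos : ∀ i, 0 < lam i) (hmono : StrictMono lam) {S : UnitarySlice (Matrix (Fin n) (Fin n) 𝔽)}
    {π : Matrix (Fin n) (Fin n) 𝔽 →ₗ[ℝ] Matrix (Fin n) (Fin n) 𝔽}
    (ha : realDiagonal 𝔽 lam ∈ S.space) (hπ : LinearMap.IsProj S.space π)
    (hmask : ∀ I h, maskEntries 𝔽 id I (π h) = π (maskEntries 𝔽 id I h))
    (hsym : ∀ I, realDiagonal 𝔽 (signs I) ∈ S.carrier →
      ∀ h ∈ S.tangent (realDiagonal 𝔽 (signs I)), ∀ x y, ‖h x y‖ = ‖h y x‖)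
    (hdim : ∀ p ∈ S.carrier, ∀ q ∈ S.carrier,
      Module.finrank ℝ (S.tangent p) = Module.finrank ℝ (S.tangent q))
    (s : Finset (Fin n) → Prop) (hs : ∀ I, s I ↔ realDiagonal 𝔽 (signs I) ∈ S.carrier)
    (r : Finset (Fin n) → ℤ)
    (hr : ∀ I, s I → ∑ x, ∑ y, (if max x y ∈ I then
      entryTrace ((1 / 2 : ℝ) • (π - sandwich (realDiagonal 𝔽 (signs I)) ∘ₗ π)) x y else 0) = r I) :
    IsMorseFunction S.carrier (distSq (realDiagonal 𝔽 lam)) ∧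
      criticalSet S.carrier (distSq (realDiagonal 𝔽 lam)) =
        {x | ∃ I, s I ∧ x = realDiagonal 𝔽 (signs I)} ∧
      ∀ I, s I → HasMorseIndex S.carrier (distSq (realDiagonal 𝔽 lam))
        (realDiagonal 𝔽 (signs I)) (r I) := by
  refine UnitarySlice.isMorseFunction_and_criticalSet (T.matrix (Fin n)) ha s _ r hdim ?_ ?_ ?_
  · intro p hp hc
    obtain ⟨I, rfl⟩ := eq_realDiagonal_signs hpos hmono hp.2.2 hc
    exact ⟨I, (hs I).2 hp, rfl⟩
  · intro I hI
    refine ⟨(hs I).1 hI, ?_⟩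
    rw [star_realDiagonal, star_realDiagonal]
    refine (realDiagonal_mul _ _).trans (Eq.trans ?_ (realDiagonal_mul _ _).symm)
    simp only [mul_comm]
  · intro I hI d c
    have hp := (hs I).1 hI
    have h := nondegenerate_and_sigNeg T hpos hmono id I
      (by rw [star_realDiagonal]; exact realDiagonal_mul _ _) (hsym I hp)
      (UnitarySlice.isProj_tangent hp hπ)
      (maskEntries_tangentProj I (fun x y hxy => realDiagonal_apply_eq_zero _ hxy) (hmask I)) c
    refine ⟨h.1, ?_⟩
    have h2 := h.2
    rw [trace_maskEntries_comp] at h2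
    exact_mod_cast h2.trans (hr I hI)

end Diagonal

end Matrix

/-! ### Sums over the positions of a matrix -/

section Sums

variable {n : ℕ} (I : Finset (Fin n))

/-- The number of positions `(x, y)` with `max x y ∈ I`: the number `j + 1 ∈ {1, …, n}`, encoded
as `j : Fin n`, is the maximum of `2 (j + 1) - 1` pairs. -/
lemma sum_max_mem : ∑ x : Fin n, ∑ y : Fin n, (if max x y ∈ I then (1 : ℝ) else 0) =
    2 * (indexSum I : ℝ) - I.card := by
  have h1 : ∀ x y : Fin n, (if max x y ∈ I then (1 : ℝ) else 0) =
      (if y ∈ I then (if x ≤ y then 1 else 0) else 0) +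
        (if x ∈ I then (if y < x then 1 else 0) else 0) := by
    intro x y
    rcases le_or_gt x y with h | h
    · simp [h, not_lt.2 h]
    · simp [h, not_le.2 h, max_eq_left h.le]
  have h2 : ∀ y : Fin n, ∑ x : Fin n, (if x ≤ y then (1 : ℝ) else 0) = (y : ℕ) + 1 := by
    intro y
    rw [Finset.sum_boole, Finset.filter_ge_eq_Iic, Fin.card_Iic]
    push_cast; ring
  have h3 : ∀ x : Fin n, ∑ y : Fin n, (if y < x then (1 : ℝ) else 0) = (x : ℕ) := by
    intro x
    rw [Finset.sum_boole, Finset.filter_gt_eq_Iio, Fin.card_Iio]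
  simp only [h1, Finset.sum_add_distrib]
  rw [Finset.sum_comm]
  have h4 : ∀ x, ∑ y : Fin n, (if x ∈ I then (if y < x then (1 : ℝ) else 0) else 0) =
      if x ∈ I then ((x : ℕ) : ℝ) else 0 := by
    intro x; split_ifs
    · exact h3 x
    · simp
  have h5 : ∀ y, ∑ x : Fin n, (if y ∈ I then (if x ≤ y then (1 : ℝ) else 0) else 0) =
      if y ∈ I then ((y : ℕ) : ℝ) + 1 else 0 := by
    intro x; split_ifs
    · exact h2 x
    · simp
  simp only [h4, h5, Finset.sum_ite_mem, Finset.univ_inter, indexSum]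
  push_cast
  simp only [Finset.sum_add_distrib, Finset.sum_const, nsmul_eq_mul, mul_one]
  ring

lemma sum_max_mem_eq : ∑ x : Fin n, ∑ y : Fin n,
    (if max x y ∈ I then (if x = y then (1 : ℝ) else 0) else 0) = I.card := by
  have h : ∀ x : Fin n, ∑ y : Fin n,
      (if max x y ∈ I then (if x = y then (1 : ℝ) else 0) else 0) = if x ∈ I then 1 else 0 := by
    intro x
    rw [Finset.sum_eq_single x]
    · simp
    · intro y _ hy; simp [hy.symm]
    · simp
  simp [h]

/-- If `x` and `y` have the same sign and `max x y ∈ I`, then both of them lie in `I`. -/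
lemma sum_max_mem_signs : ∑ x : Fin n, ∑ y : Fin n,
    (if max x y ∈ I then (1 + signs I x * signs I y) / 2 else 0) = (I.card : ℝ) ^ 2 := by
  have h : ∀ x y : Fin n, (if max x y ∈ I then (1 + signs I x * signs I y) / 2 else 0) =
      (if x ∈ I then (1 : ℝ) else 0) * (if y ∈ I then (1 : ℝ) else 0) := by
    intro x y
    unfold signs
    rcases le_total x y with h | h
    · rw [max_eq_right h]; split_ifs <;> norm_num
    · rw [max_eq_left h]; split_ifs <;> norm_num
  simp only [h, ← Finset.mul_sum, ← Finset.sum_mul]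
  simp [sq]

end Sums

/-! ### Orthogonal, unitary and symplectic groups -/

namespace Matrix

attribute [local instance] frobeniusNormedRingOfNormedRing frobeniusNormedAlgebraOfNormedRing

section Orthogonal

variable {n : ℕ} {𝔽 : Type} [NormedRing 𝔽] [NormedAlgebra ℝ 𝔽] [StarRing 𝔽] [StarModule ℝ 𝔽]
  [FiniteDimensional ℝ 𝔽]

variable (n 𝔽) in
/-- The group of unitary matrices as a slice. -/
noncomputable def orthogonalSlice : UnitarySlice (Matrix (Fin n) (Fin n) 𝔽) where
  space := ⊤
  dom := Set.univ
  isOpen_dom := isOpen_univ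
  sandwich_mem _ _ := Submodule.mem_top
  star_inverse_mem _ _ _ := Submodule.mem_top

omit [StarModule ℝ 𝔽] [FiniteDimensional ℝ 𝔽] in
lemma carrier_orthogonalSlice : (orthogonalSlice n 𝔽).carrier = orthogonalManifold n 𝔽 := by
  ext x
  exact ⟨fun h => h.2.2, fun h => ⟨Submodule.mem_top, trivial, h⟩⟩

/-- Left multiplication by `q p*` maps the tangent space at `p` to the one at `q`. -/
lemma finrank_tangent_orthogonalSlice_le {p q : Matrix (Fin n) (Fin n) 𝔽}
    (hp : p ∈ (orthogonalSlice n 𝔽).carrier) (hq : q ∈ (orthogonalSlice n 𝔽).carrier) :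
    Module.finrank ℝ ((orthogonalSlice n 𝔽).tangent p) ≤
      Module.finrank ℝ ((orthogonalSlice n 𝔽).tangent q) := by
  have hinj : Function.Injective (LinearMap.mulLeft ℝ (q * star p)) := by
    intro h k hk
    have h1 : p * star q * (q * star p * h) = p * star q * (q * star p * k) :=
      congrArg (p * star q * ·) hk
    have h2 : ∀ h, p * star q * (q * star p * h) = h := by
      intro h
      calc p * star q * (q * star p * h) = p * (star q * q) * star p * h := by
            simp only [Matrix.mul_assoc]
        _ = p * star p * h := by rw [show star q * q = 1 from hq.2.2, Matrix.mul_one]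
        _ = h := by rw [show p * star p = 1 from mul_star_self_of_star_mul_self hp.2.2,
                  Matrix.one_mul]
    rwa [h2, h2] at h1
  rw [(Submodule.equivMapOfInjective _ hinj _).finrank_eq]
  refine Submodule.finrank_mono ?_
  rintro _ ⟨h, hh, rfl⟩
  refine ⟨Submodule.mem_top, ?_⟩
  change star q * (q * star p * h) + star (q * star p * h) * q = 0
  have h1 : star q * (q * star p * h) = star p * h := by
    rw [← Matrix.mul_assoc, ← Matrix.mul_assoc, show star q * q = 1 from hq.2.2, Matrix.one_mul]
  have h2 : star (q * star p * h) * q = star h * p := by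
    rw [star_mul, star_mul, star_star, Matrix.mul_assoc, Matrix.mul_assoc,
      show star q * q = 1 from hq.2.2, Matrix.mul_one]
  rw [h1, h2]
  exact hh.2

/-- The trace of the conjugation `z ↦ 2 (Re z) - z`. -/
lemma trace_star (T : TraceForm 𝔽) (h1 : T.tr 1 = 1) (h2 : ∀ z, star z = (2 * T.tr z) • 1 - z) :
    LinearMap.trace ℝ 𝔽 (starCLM 𝔽 : 𝔽 →ₗ[ℝ] 𝔽) = 2 - Module.finrank ℝ 𝔽 := by
  have : (starCLM 𝔽 : 𝔽 →ₗ[ℝ] 𝔽) = (2 : ℝ) • T.tr.smulRight 1 - LinearMap.id := by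
    ext z
    simp [h2, smul_smul]
  rw [this, map_sub, map_smul, LinearMap.trace_smulRight, LinearMap.trace_id, h1]
  simp

lemma entryTrace_orthogonal (T : TraceForm 𝔽) (h1 : T.tr 1 = 1)
    (h2 : ∀ z, star z = (2 * T.tr z) • 1 - z) (I : Finset (Fin n)) (x y : Fin n) :
    entryTrace ((1 / 2 : ℝ) •
      (LinearMap.id - sandwich (realDiagonal 𝔽 (signs I)) ∘ₗ LinearMap.id)) x y =
      (1 / 2) * (Module.finrank ℝ 𝔽 - if x = y then 2 - (Module.finrank ℝ 𝔽 : ℝ) else 0) := by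
  rw [entryTrace_smul]
  congr 1
  have e : (entryLinearMap ℝ 𝔽 x y ∘ₗ (LinearMap.id - sandwich (realDiagonal 𝔽 (signs I)) ∘ₗ
      LinearMap.id) ∘ₗ singleLinearMap ℝ x y) =
      LinearMap.id - if x = y then (starCLM 𝔽 : 𝔽 →ₗ[ℝ] 𝔽) else 0 := by
    ext z
    have h3 : (realDiagonal 𝔽 (signs I) * star (single x y z) * realDiagonal 𝔽 (signs I)) x y =
        if x = y then star z else 0 := by
      rw [star_eq_conjTranspose, conjTranspose_single, mul_single_mul_apply]
      by_cases hxy : x = y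
      · subst hxy
        rw [if_pos rfl, realDiagonal, diagonal_apply_eq, ← Algebra.commutes, ← mul_assoc,
          ← map_mul, signs_mul_self, map_one, one_mul]
      · rw [realDiagonal_apply_eq_zero _ hxy, if_neg hxy, zero_mul, zero_mul]
    change single x y z x y -
      (realDiagonal 𝔽 (signs I) * star (single x y z) * realDiagonal 𝔽 (signs I)) x y = _
    rw [h3, single_apply_same]
    split_ifs <;> simp
  rw [entryTrace, e, map_sub, LinearMap.trace_id]
  split_ifs
  · rw [trace_star T h1 h2]
  · simp

/-- A tangent vector at `σ = diag (ε_1, …, ε_n)` satisfies `h = -σ h* σ`. -/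
lemma norm_apply_eq_of_mem_tangent (T : TraceForm 𝔽)
    {S : UnitarySlice (Matrix (Fin n) (Fin n) 𝔽)} {I : Finset (Fin n)}
    (hI : realDiagonal 𝔽 (signs I) ∈ S.carrier) {h : Matrix (Fin n) (Fin n) 𝔽}
    (hh : h ∈ S.tangent (realDiagonal 𝔽 (signs I))) (x y : Fin n) : ‖h x y‖ = ‖h y x‖ := by
  have h0 := UnitarySlice.sandwich_eq_neg hI hh
  have h1 := congrFun (congrFun h0 x) y
  change (realDiagonal 𝔽 (signs I) * star h * realDiagonal 𝔽 (signs I)) x y = -h x y at h1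
  rw [realDiagonal, mul_diagonal, diagonal_mul, ← Algebra.commutes, ← Algebra.smul_def,
    ← Algebra.smul_def, star_apply] at h1
  have h2 : ∀ x, ‖signs I x‖ = 1 := by intro x; unfold signs; split_ifs <;> simp
  rw [← norm_neg, ← h1, norm_smul, norm_smul, h2, h2, one_mul, one_mul, T.norm_star]

theorem morse_orthogonalManifold [NoZeroDivisors 𝔽] (T : TraceForm 𝔽) (h1 : T.tr 1 = 1)
    (h2 : ∀ z, star z = (2 * T.tr z) • 1 - z) {lam : Fin n → ℝ}
    (hpos : ∀ i, 0 < lam i) (hmono : StrictMono lam) :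
    IsMorseFunction (orthogonalManifold n 𝔽) (distSq (realDiagonal 𝔽 lam)) ∧
      criticalSet (orthogonalManifold n 𝔽) (distSq (realDiagonal 𝔽 lam)) =
        {x | ∃ I : Finset (Fin n), x = realDiagonal 𝔽 (signs I)} ∧
      ∀ I : Finset (Fin n),
        HasMorseIndex (orthogonalManifold n 𝔽) (distSq (realDiagonal 𝔽 lam))
          (realDiagonal 𝔽 (signs I)) (Module.finrank ℝ 𝔽 * indexSum I - I.card) := by
  have hcar : ∀ I : Finset (Fin n), realDiagonal 𝔽 (signs I) ∈ (orthogonalSlice n 𝔽).carrier :=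
    fun I => ⟨Submodule.mem_top, trivial, star_realDiagonal_signs_mul_self I⟩
  have := morse_realDiagonal T hpos hmono (S := orthogonalSlice n 𝔽) (π := LinearMap.id)
    Submodule.mem_top ⟨fun _ => Submodule.mem_top, fun _ _ => rfl⟩ (fun _ _ => rfl)
    (fun I hI h hh => norm_apply_eq_of_mem_tangent T hI hh)
    (fun p hp q hq => le_antisymm (finrank_tangent_orthogonalSlice_le hp hq)
      (finrank_tangent_orthogonalSlice_le hq hp))
    (fun _ => True) (fun I => ⟨fun _ => hcar I, fun _ => trivial⟩)
    (fun I => Module.finrank ℝ 𝔽 * indexSum I - I.card) ?_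
  · rw [carrier_orthogonalSlice] at this
    simpa only [true_and, forall_const] using this
  · intro I _
    simp only [entryTrace_orthogonal T h1 h2]
    have e : ∀ x y : Fin n, (if max x y ∈ I then (1 / 2) * ((Module.finrank ℝ 𝔽 : ℝ) -
        if x = y then 2 - (Module.finrank ℝ 𝔽 : ℝ) else 0) else 0) =
        (Module.finrank ℝ 𝔽 : ℝ) / 2 * (if max x y ∈ I then 1 else 0) -
        (2 - (Module.finrank ℝ 𝔽 : ℝ)) / 2 *
          (if max x y ∈ I then (if x = y then 1 else 0) else 0) := by
      intro x y
      split_ifs <;> ring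
    simp only [e, Finset.sum_sub_distrib, ← Finset.mul_sum, sum_max_mem, sum_max_mem_eq]
    push_cast
    ring

end Orthogonal

section Coefficients

/-- The identity of `ℝ` as a trace form. -/
noncomputable def realTraceForm : TraceForm ℝ where
  tr := LinearMap.id
  tr_mul_comm x y := mul_comm x y
  tr_star x := by simp
  tr_star_mul_self x := by simp [sq]

/-- The real part as a trace form on `ℂ`. -/
noncomputable def complexTraceForm : TraceForm ℂ where
  tr := Complex.reLm
  tr_mul_comm x y := by rw [mul_comm]
  tr_star x := by simp
  tr_star_mul_self x := by
    rw [← Complex.normSq_eq_norm_sq, Complex.normSq_apply]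
    simp

/-- The real part as a trace form on the quaternions. -/
noncomputable def quaternionTraceForm : TraceForm (Quaternion ℝ) where
  tr := QuaternionAlgebra.reₗ _ _ _
  tr_mul_comm x y := by
    change (x * y).re = (y * x).re
    rw [Quaternion.re_mul, Quaternion.re_mul]
    ring
  tr_star x := by
    change (star x).re = x.re
    simp
  tr_star_mul_self x := by
    change (star x * x).re = _
    rw [Quaternion.star_mul_self, Quaternion.re_coe, Quaternion.normSq_eq_norm_mul_self, sq]

end Coefficients

lemma trace_linearMap_complex (f : ℂ →ₗ[ℝ] ℂ) :
    LinearMap.trace ℝ ℂ f = (f 1).re + (f Complex.I).im := by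
  rw [LinearMap.trace_eq_matrix_trace ℝ Complex.basisOneI, Matrix.trace]
  simp [LinearMap.toMatrix_apply]

lemma entryTrace_complex {κ : Type*} [DecidableEq κ] (L : Matrix κ κ ℂ →ₗ[ℝ] Matrix κ κ ℂ)
    (x y : κ) : entryTrace L x y =
      (L (single x y 1) x y).re + (L (single x y Complex.I) x y).im := by
  rw [entryTrace, trace_linearMap_complex]
  rfl

variable {n : ℕ}

/-! ### The Lagrangian Grassmannian -/

section Lagrangian

variable (n) in
/-- The symmetric unitary matrices as a slice. -/
noncomputable def lagrangianSlice : UnitarySlice (Matrix (Fin n) (Fin n) ℂ) where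
  space :=
    { carrier := {x | xᵀ = x}
      add_mem' := fun {x y} hx hy => by
        change (x + y)ᵀ = x + y
        rw [transpose_add, show xᵀ = x from hx, show yᵀ = y from hy]
      zero_mem' := transpose_zero
      smul_mem' := fun r x hx => by
        change (r • x)ᵀ = r • x
        rw [transpose_smul, show xᵀ = x from hx] }
  dom := Set.univ
  isOpen_dom := isOpen_univ
  sandwich_mem := fun {x y} hx hy => by
    change (x * yᴴ * x)ᵀ = x * yᴴ * x
    rw [transpose_mul, transpose_mul, show (yᴴ)ᵀ = (yᵀ)ᴴ from rfl, show xᵀ = x from hx,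
      show yᵀ = y from hy, Matrix.mul_assoc]
  star_inverse_mem := fun {x y} hx hxy hyx => by
    change (yᴴ)ᵀ = yᴴ
    have h : yᵀ * x = 1 := by
      rw [← transpose_one, ← show x * y = 1 from hxy, transpose_mul, show xᵀ = x from hx]
    have h' : yᵀ = y := by
      calc yᵀ = yᵀ * (x * y) := by rw [show x * y = 1 from hxy, Matrix.mul_one]
        _ = y := by rw [← Matrix.mul_assoc, h, Matrix.one_mul]
    rw [show (yᴴ)ᵀ = (yᵀ)ᴴ from rfl, h']

lemma carrier_lagrangianSlice : (lagrangianSlice n).carrier = lagrangianManifold n := by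
  ext x
  have h : xᵀ = x → x.map (starRingEnd ℂ) = star x := fun hx => by
    conv_rhs => rw [← hx]
    rfl
  constructor
  · rintro ⟨hx, -, h1⟩
    exact ⟨hx, by rw [h hx]; exact h1⟩
  · rintro ⟨hx, h1⟩
    exact ⟨hx, trivial, by rw [h hx] at h1; exact h1⟩

variable (n) in
/-- The projection to the symmetric matrices. -/
noncomputable def symmetrize : Matrix (Fin n) (Fin n) ℂ →ₗ[ℝ] Matrix (Fin n) (Fin n) ℂ :=
  (1 / 2 : ℝ) • (LinearMap.id + (transposeLinearEquiv (Fin n) (Fin n) ℝ ℂ).toLinearMap)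

lemma symmetrize_apply (h : Matrix (Fin n) (Fin n) ℂ) :
    symmetrize n h = (1 / 2 : ℝ) • (h + hᵀ) := rfl

lemma isProj_symmetrize : LinearMap.IsProj (lagrangianSlice n).space (symmetrize n) := by
  constructor
  · intro h
    change (symmetrize n h)ᵀ = symmetrize n h
    rw [symmetrize_apply, transpose_smul, transpose_add, transpose_transpose, add_comm]
  · intro h hh
    rw [symmetrize_apply, show hᵀ = h from hh, ← two_smul ℝ h, smul_smul]
    norm_num

/-- The conjugate linear part of the projection does not contribute to its trace. -/
lemma entryTrace_lagrangian (p : Matrix (Fin n) (Fin n) ℂ) (x y : Fin n) :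
    entryTrace ((1 / 2 : ℝ) • (symmetrize n - sandwich p ∘ₗ symmetrize n)) x y =
      (1 / 2) * (1 + if x = y then 1 else 0) := by
  have e : ∀ z, ((symmetrize n - sandwich p ∘ₗ symmetrize n) (single x y z)) x y =
      (1 / 2 : ℝ) • (z + if x = y then z else 0) -
        (1 / 2 : ℝ) • (star z * (p x y * p x y + p x x * p y y)) := by
    intro z
    have h1 : (symmetrize n (single x y z)) x y = (1 / 2 : ℝ) • (z + if x = y then z else 0) := by
      rw [symmetrize_apply, transpose_single, smul_apply, add_apply, single_apply_same,
        single_apply]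
      by_cases h : x = y
      · simp [h]
      · simp [h, Ne.symm h]
    have h2 : (p * (symmetrize n (single x y z))ᴴ * p) x y =
        (1 / 2 : ℝ) • (star z * (p x y * p x y + p x x * p y y)) := by
      rw [symmetrize_apply, transpose_single, conjTranspose_smul, conjTranspose_add,
        conjTranspose_single, conjTranspose_single, Matrix.mul_smul, Matrix.smul_mul,
        Matrix.mul_add, Matrix.add_mul, smul_apply, add_apply, mul_single_mul_apply,
        mul_single_mul_apply, star_trivial]
      congr 1
      ring
    rw [← h1, ← h2]
    rfl
  rw [entryTrace_smul, entryTrace_complex, e, e]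
  split_ifs <;> simp <;> ring

theorem morse_lagrangianManifold {lam : Fin n → ℝ} (hpos : ∀ i, 0 < lam i)
    (hmono : StrictMono lam) :
    IsMorseFunction (lagrangianManifold n) (distSq (realDiagonal ℂ lam)) ∧
      criticalSet (lagrangianManifold n) (distSq (realDiagonal ℂ lam)) =
        {x | ∃ I : Finset (Fin n), x = realDiagonal ℂ (signs I)} ∧
      ∀ I : Finset (Fin n),
        HasMorseIndex (lagrangianManifold n) (distSq (realDiagonal ℂ lam))
          (realDiagonal ℂ (signs I)) (indexSum I) := by
  have hV : ∀ v : Fin n → ℝ, realDiagonal ℂ v ∈ (lagrangianSlice n).space :=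
    fun v => diagonal_transpose _
  have hcar : ∀ I : Finset (Fin n), realDiagonal ℂ (signs I) ∈ (lagrangianSlice n).carrier :=
    fun I => ⟨hV _, trivial, star_realDiagonal_signs_mul_self I⟩
  have := morse_realDiagonal complexTraceForm hpos hmono (hV lam) isProj_symmetrize
    (fun I h => by
      rw [symmetrize_apply, symmetrize_apply, map_smul, map_add, maskEntries_transpose])
    (fun I hI h hh x y => norm_apply_eq_of_mem_tangent complexTraceForm hI hh x y)
    (finrank_tangent_eq isProj_symmetrize fun p _ => by simp only [entryTrace_lagrangian]; rfl)
    (fun _ => True) (fun I => ⟨fun _ => hcar I, fun _ => trivial⟩) indexSum ?_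
  · rw [carrier_lagrangianSlice] at this
    simpa only [true_and, forall_const] using this
  · intro I _
    simp only [entryTrace_lagrangian]
    have e : ∀ x y : Fin n, (if max x y ∈ I then (1 / 2) * (1 + if x = y then (1 : ℝ) else 0)
        else 0) = (1 / 2) * (if max x y ∈ I then 1 else 0) +
        (1 / 2) * (if max x y ∈ I then (if x = y then 1 else 0) else 0) := by
      intro x y
      split_ifs <;> ring
    simp only [e, Finset.sum_add_distrib, ← Finset.mul_sum, sum_max_mem, sum_max_mem_eq]
    ring

end Lagrangian

/-! ### The Grassmannians -/

section Grassmannian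

lemma IsHermitian.eigenvalues_mul_self {x : Matrix (Fin n) (Fin n) ℂ} (hx : x.IsHermitian)
    (h : x * x = 1) (i : Fin n) : hx.eigenvalues i * hx.eigenvalues i = 1 := by
  have h1 := hx.mulVec_eigenvectorBasis i
  have h2 : x *ᵥ (x *ᵥ (hx.eigenvectorBasis i)) = hx.eigenvectorBasis i := by
    rw [mulVec_mulVec, h, one_mulVec]
  rw [h1, mulVec_smul, h1, smul_smul] at h2
  have h3 : (hx.eigenvectorBasis i).ofLp ≠ 0 := by
    intro h0
    exact hx.eigenvectorBasis.orthonormal.ne_zero i (by ext j; exact congrFun h0 j)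
  have h4 : (hx.eigenvalues i * hx.eigenvalues i - 1) • (hx.eigenvectorBasis i).ofLp = 0 := by
    rw [sub_smul, h2, one_smul, sub_self]
  rcases smul_eq_zero.1 h4 with h5 | h5
  · linarith
  · exact absurd h5 h3

/-- All eigenvalues are `1` or `-1`. -/
lemma re_trace_eq {x : Matrix (Fin n) (Fin n) ℂ} (hx : x.IsHermitian) (h : x * x = 1) :
    x.trace.re = n - 2 * (Finset.univ.filter fun i => hx.eigenvalues i < 0).card := by
  have e : ∀ i, hx.eigenvalues i = 1 - 2 * (if hx.eigenvalues i < 0 then 1 else 0) := by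
    intro i
    rcases mul_self_eq_one_iff.1 (hx.eigenvalues_mul_self h i) with h1 | h1 <;> norm_num [h1]
  rw [hx.trace_eq_sum_eigenvalues, Complex.re_sum]
  simp only [RCLike.ofReal_eq_complex_ofReal, Complex.ofReal_re]
  rw [Finset.sum_congr rfl fun i _ => e i, Finset.sum_sub_distrib, ← Finset.mul_sum,
    Finset.sum_boole]
  simp

lemma eq_of_abs_sub_lt_one {n c k : ℕ} (h : |(n - 2 * c : ℝ) - (n - 2 * k)| < 1) : c = k := by
  rw [show (n - 2 * c : ℝ) - (n - 2 * k) = ((2 * ((k : ℤ) - c) : ℤ) : ℝ) by push_cast; ring,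
    ← Int.cast_abs] at h
  have : |2 * ((k : ℤ) - c)| < 1 := by exact_mod_cast h
  rw [Int.abs_lt_one_iff] at this
  omega

variable (n) in
/-- The Hermitian unitary matrices with `k` negative eigenvalues as a slice. The trace of a
Hermitian unitary matrix determines the number of its negative eigenvalues. -/
noncomputable def grassmannSlice (k : ℕ) : UnitarySlice (Matrix (Fin n) (Fin n) ℂ) where
  space :=
    { carrier := {x | xᴴ = x}
      add_mem' := fun {x y} hx hy => by
        change (x + y)ᴴ = x + y
        rw [conjTranspose_add, show xᴴ = x from hx, show yᴴ = y from hy]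
      zero_mem' := conjTranspose_zero
      smul_mem' := fun r x hx => by
        change (r • x)ᴴ = r • x
        rw [conjTranspose_smul, star_trivial, show xᴴ = x from hx] }
  dom := {x | |x.trace.re - (n - 2 * k)| < 1}
  isOpen_dom := by
    have h : Continuous fun x : Matrix (Fin n) (Fin n) ℂ => x.trace.re :=
      (Complex.reLm ∘ₗ traceLinearMap (Fin n) ℝ ℂ).continuous_of_finiteDimensional
    exact isOpen_lt (by fun_prop) continuous_const
  sandwich_mem := fun {x y} hx hy => by
    change (x * yᴴ * x)ᴴ = x * yᴴ * x
    rw [conjTranspose_mul, conjTranspose_mul, conjTranspose_conjTranspose, show xᴴ = x from hx,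
      show yᴴ = y from hy, Matrix.mul_assoc]
  star_inverse_mem := fun {x y} hx hxy hyx => by
    change (yᴴ)ᴴ = yᴴ
    have h : yᴴ * x = 1 := by
      rw [← conjTranspose_one, ← show x * y = 1 from hxy, conjTranspose_mul, show xᴴ = x from hx]
    have h' : yᴴ = y := by
      calc yᴴ = yᴴ * (x * y) := by rw [show x * y = 1 from hxy, Matrix.mul_one]
        _ = y := by rw [← Matrix.mul_assoc, h, Matrix.one_mul]
    rw [h', h']

lemma carrier_grassmannSlice (k : ℕ) : (grassmannSlice n k).carrier = grassmannManifold n k := by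
  ext x
  constructor
  · rintro ⟨hx, htr, h1⟩
    have hx' : x.IsHermitian := hx
    have h2 : x * x = 1 := by
      have : xᴴ * x = 1 := h1
      rwa [hx'.eq] at this
    refine ⟨hx', h2, eq_of_abs_sub_lt_one (n := n) ?_⟩
    rw [← re_trace_eq hx' h2]
    exact htr
  · rintro ⟨hx, h2, hk⟩
    refine ⟨hx, ?_, ?_⟩
    · change |x.trace.re - (n - 2 * k)| < 1
      rw [re_trace_eq hx h2, hk]
      simp
    · change xᴴ * x = 1
      rw [hx.eq, h2]

variable (n) in
/-- The projection to the Hermitian matrices. -/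
noncomputable def hermitize : Matrix (Fin n) (Fin n) ℂ →ₗ[ℝ] Matrix (Fin n) (Fin n) ℂ :=
  (1 / 2 : ℝ) • (LinearMap.id + (starCLM (Matrix (Fin n) (Fin n) ℂ) : _ →ₗ[ℝ] _))

lemma hermitize_apply (h : Matrix (Fin n) (Fin n) ℂ) :
    hermitize n h = (1 / 2 : ℝ) • (h + hᴴ) := rfl

lemma conjTranspose_hermitize (h : Matrix (Fin n) (Fin n) ℂ) :
    (hermitize n h)ᴴ = hermitize n h := by
  rw [hermitize_apply, conjTranspose_smul, conjTranspose_add, conjTranspose_conjTranspose,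
    add_comm, star_trivial]

lemma isProj_hermitize (k : ℕ) : LinearMap.IsProj (grassmannSlice n k).space (hermitize n) := by
  constructor
  · exact conjTranspose_hermitize
  · intro h hh
    rw [hermitize_apply, show hᴴ = h from hh, ← two_smul ℝ h, smul_smul]
    norm_num

lemma entryTrace_grassmann (p : Matrix (Fin n) (Fin n) ℂ) (x y : Fin n) :
    entryTrace ((1 / 2 : ℝ) • (hermitize n - sandwich p ∘ₗ hermitize n)) x y =
      (1 / 2) * (1 - (p x x * p y y).re) := by
  have e : ∀ z, ((hermitize n - sandwich p ∘ₗ hermitize n) (single x y z)) x y =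
      (1 / 2 : ℝ) • (z + if x = y then star z else 0) -
        (1 / 2 : ℝ) • (z * (p x x * p y y) + star z * (p x y * p x y)) := by
    intro z
    have h1 : (hermitize n (single x y z)) x y =
        (1 / 2 : ℝ) • (z + if x = y then star z else 0) := by
      rw [hermitize_apply, conjTranspose_single, smul_apply, add_apply, single_apply_same,
        single_apply]
      by_cases h : x = y
      · simp [h]
      · simp [h, Ne.symm h]
    have h2 : (p * (hermitize n (single x y z))ᴴ * p) x y =
        (1 / 2 : ℝ) • (z * (p x x * p y y) + star z * (p x y * p x y)) := by
      rw [conjTranspose_hermitize, hermitize_apply, conjTranspose_single, Matrix.mul_smul,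
        Matrix.smul_mul, Matrix.mul_add, Matrix.add_mul, smul_apply, add_apply,
        mul_single_mul_apply, mul_single_mul_apply]
      congr 1
      ring
    rw [← h1, ← h2]
    rfl
  rw [entryTrace_smul, entryTrace_complex, e, e]
  split_ifs <;> simp <;> ring

lemma two_mul_sum_orderEmbOfFin {k : ℕ} (I : Finset (Fin n)) (hI : I.card = k) :
    2 * ∑ s : Fin k, (((I.orderEmbOfFin hI s : ℕ) + 1 : ℤ) - ((s : ℕ) + 1 : ℤ)) =
      2 * indexSum I - I.card - (I.card : ℤ) ^ 2 := by
  have h1 : ∑ s : Fin k, ((I.orderEmbOfFin hI s : ℕ) + 1 : ℤ) = indexSum I := by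
    rw [indexSum]
    conv_rhs => rw [← Finset.map_orderEmbOfFin_univ I hI, Finset.sum_map]
    rfl
  have h2 : 2 * ∑ s : Fin k, ((s : ℕ) + 1 : ℤ) = k + (k : ℤ) ^ 2 := by
    rw [Fin.sum_univ_eq_sum_range (fun i => (i + 1 : ℤ)) k]
    clear hI h1
    induction k with
    | zero => simp
    | succ m ih =>
      rw [Finset.sum_range_succ, mul_add, ih]
      push_cast
      ring
  rw [Finset.sum_sub_distrib, mul_sub, h1, h2, hI]
  ring

lemma sum_signs (I : Finset (Fin n)) : ∑ x, signs I x = n - 2 * I.card := by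
  have h : ∀ x, signs I x = 1 - 2 * (if x ∈ I then 1 else 0) := by
    intro x; unfold signs; split_ifs <;> norm_num
  simp only [h, Finset.sum_sub_distrib, ← Finset.mul_sum]
  simp

theorem morse_grassmannManifold {lam : Fin n → ℝ} (hpos : ∀ i, 0 < lam i)
    (hmono : StrictMono lam) (k : ℕ) :
    IsMorseFunction (grassmannManifold n k) (distSq (realDiagonal ℂ lam)) ∧
      criticalSet (grassmannManifold n k) (distSq (realDiagonal ℂ lam)) =
        {x | ∃ I : Finset (Fin n), I.card = k ∧ x = realDiagonal ℂ (signs I)} ∧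
      ∀ (I : Finset (Fin n)) (hI : I.card = k),
        HasMorseIndex (grassmannManifold n k) (distSq (realDiagonal ℂ lam))
          (realDiagonal ℂ (signs I))
          (2 * ∑ s : Fin k, (((I.orderEmbOfFin hI s : ℕ) + 1 : ℤ) - ((s : ℕ) + 1 : ℤ))) := by
  have hV : ∀ v : Fin n → ℝ, realDiagonal ℂ v ∈ (grassmannSlice n k).space :=
    fun v => star_realDiagonal v
  have hcar : ∀ I : Finset (Fin n),
      I.card = k ↔ realDiagonal ℂ (signs I) ∈ (grassmannSlice n k).carrier := by
    intro I
    have htr : (realDiagonal ℂ (signs I)).trace.re = n - 2 * I.card := by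
      rw [← sum_signs, realDiagonal, trace_diagonal, Complex.re_sum]
      simp
    have hmem : realDiagonal ℂ (signs I) ∈ (grassmannSlice n k).carrier ↔
        |(realDiagonal ℂ (signs I)).trace.re - (n - 2 * k)| < 1 :=
      ⟨fun h => h.2.1, fun h => ⟨hV _, h, star_realDiagonal_signs_mul_self I⟩⟩
    rw [hmem, htr]
    constructor
    · intro h
      simp [h]
    · exact eq_of_abs_sub_lt_one
  have hdim : ∀ p ∈ (grassmannSlice n k).carrier, ∑ x, ∑ y,
      entryTrace ((1 / 2 : ℝ) • (hermitize n - sandwich p ∘ₗ hermitize n)) x y =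
        (1 / 2) * ((n : ℝ) ^ 2 - (n - 2 * k) ^ 2) := by
    intro p hp
    rw [carrier_grassmannSlice] at hp
    obtain ⟨hh, h2, hk⟩ := hp
    have htr := re_trace_eq hh h2
    rw [hk] at htr
    have him : p.trace.im = 0 := by
      have : star p.trace = p.trace := by rw [← trace_conjTranspose, hh.eq]
      exact Complex.conj_eq_iff_im.1 this
    have hsum : ∑ x, ∑ y, (p x x * p y y).re = (n - 2 * k : ℝ) ^ 2 := by
      simp only [← Complex.re_sum, ← Finset.mul_sum, ← Finset.sum_mul]
      change (p.trace * p.trace).re = _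
      rw [Complex.mul_re, him, htr]
      ring
    simp only [entryTrace_grassmann, ← Finset.mul_sum, Finset.sum_sub_distrib, hsum]
    simp [sq]
  have := morse_realDiagonal complexTraceForm hpos hmono (hV lam) (isProj_hermitize k)
    (fun I h => by
      rw [hermitize_apply, hermitize_apply, map_smul, map_add]
      congr 2
      exact maskEntries_star I h)
    (fun I hI h hh x y => norm_apply_eq_of_mem_tangent complexTraceForm hI hh x y)
    (finrank_tangent_eq (isProj_hermitize k) hdim)
    (fun I => I.card = k) hcar (fun I => 2 * indexSum I - I.card - (I.card : ℤ) ^ 2) ?_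
  · rw [carrier_grassmannSlice] at this
    refine ⟨this.1, this.2.1, fun I hI => ?_⟩
    rw [two_mul_sum_orderEmbOfFin]
    exact this.2.2 I hI
  · intro I _
    have e : ∀ x y : Fin n, (if max x y ∈ I then entryTrace ((1 / 2 : ℝ) •
        (hermitize n - sandwich (realDiagonal ℂ (signs I)) ∘ₗ hermitize n)) x y else 0) =
        (if max x y ∈ I then (1 : ℝ) else 0) -
          (if max x y ∈ I then (1 + signs I x * signs I y) / 2 else 0) := by
      intro x y
      rw [entryTrace_grassmann, realDiagonal, diagonal_apply_eq, diagonal_apply_eq, ← map_mul]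
      simp only [Complex.coe_algebraMap, Complex.ofReal_re]
      split_ifs <;> ring
    simp only [e, Finset.sum_sub_distrib, sum_max_mem, sum_max_mem_signs]
    push_cast
    ring

end Grassmannian

/-! ### The space of complex structures -/

section ComplexStructures

variable (n) in
/-- The skew-symmetric orthogonal matrices of size `2n` as a slice. -/
noncomputable def complexStructureSlice :
    UnitarySlice (Matrix (Fin 2 × Fin n) (Fin 2 × Fin n) ℝ) where
  space :=
    { carrier := {x | xᵀ = -x}
      add_mem' := fun {x y} hx hy => by
        change (x + y)ᵀ = -(x + y)
        rw [transpose_add, show xᵀ = -x from hx, show yᵀ = -y from hy, neg_add]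
      zero_mem' := by simp
      smul_mem' := fun r x hx => by
        change (r • x)ᵀ = -(r • x)
        rw [transpose_smul, show xᵀ = -x from hx, smul_neg] }
  dom := Set.univ
  isOpen_dom := isOpen_univ
  sandwich_mem := fun {x y} hx hy => by
    change (x * yᴴ * x)ᵀ = -(x * yᴴ * x)
    rw [conjTranspose_eq_transpose_of_trivial, transpose_mul, transpose_mul, transpose_transpose,
      show xᵀ = -x from hx, show yᵀ = -y from hy]
    simp [Matrix.mul_assoc]
  star_inverse_mem := fun {x y} hx hxy hyx => by
    change (yᴴ)ᵀ = -yᴴ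
    have h : yᵀ * x = -1 := by
      rw [← transpose_one, ← show x * y = 1 from hxy, transpose_mul, show xᵀ = -x from hx,
        Matrix.mul_neg, neg_neg]
    have h' : yᵀ = -y := by
      calc yᵀ = yᵀ * (x * y) := by rw [show x * y = 1 from hxy, Matrix.mul_one]
        _ = -y := by rw [← Matrix.mul_assoc, h, Matrix.neg_mul, Matrix.one_mul]
    rw [conjTranspose_eq_transpose_of_trivial, h', transpose_neg, h']

lemma carrier_complexStructureSlice :
    (complexStructureSlice n).carrier = complexStructureManifold n := by
  ext x
  have key : xᵀ = -x → (star x * x = 1 ↔ x * x = -1) := fun hx => by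
    rw [star_eq_conjTranspose, conjTranspose_eq_transpose_of_trivial, hx, Matrix.neg_mul,
      neg_eq_iff_eq_neg]
  constructor
  · rintro ⟨hx, -, h1⟩
    exact ⟨hx, (key hx).1 h1⟩
  · rintro ⟨hx, h1⟩
    exact ⟨hx, trivial, (key hx).2 h1⟩

variable (n) in
/-- The projection to the skew-symmetric matrices. -/
noncomputable def skewSymmetrize : Matrix (Fin 2 × Fin n) (Fin 2 × Fin n) ℝ →ₗ[ℝ]
    Matrix (Fin 2 × Fin n) (Fin 2 × Fin n) ℝ :=
  (1 / 2 : ℝ) •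
    (LinearMap.id - (transposeLinearEquiv (Fin 2 × Fin n) (Fin 2 × Fin n) ℝ ℝ).toLinearMap)

lemma skewSymmetrize_apply (h : Matrix (Fin 2 × Fin n) (Fin 2 × Fin n) ℝ) :
    skewSymmetrize n h = (1 / 2 : ℝ) • (h - hᵀ) := rfl

lemma isProj_skewSymmetrize :
    LinearMap.IsProj (complexStructureSlice n).space (skewSymmetrize n) := by
  constructor
  · intro h
    change (skewSymmetrize n h)ᵀ = -skewSymmetrize n h
    rw [skewSymmetrize_apply, transpose_smul, transpose_sub, transpose_transpose, ← smul_neg,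
      neg_sub]
  · intro h hh
    rw [skewSymmetrize_apply, show hᵀ = -h from hh, sub_neg_eq_add, ← two_smul ℝ h, smul_smul]
    norm_num

lemma entryTrace_real {κ : Type*} [DecidableEq κ] (L : Matrix κ κ ℝ →ₗ[ℝ] Matrix κ κ ℝ)
    (x y : κ) : entryTrace L x y = L (single x y 1) x y := by
  rw [entryTrace, LinearMap.trace_eq_matrix_trace ℝ (Module.Basis.singleton Unit ℝ), Matrix.trace]
  simp [LinearMap.toMatrix_apply]

lemma entryTrace_complexStructure {p : Matrix (Fin 2 × Fin n) (Fin 2 × Fin n) ℝ} (hp : pᵀ = -p)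
    (x y : Fin 2 × Fin n) :
    entryTrace ((1 / 2 : ℝ) • (skewSymmetrize n - sandwich p ∘ₗ skewSymmetrize n)) x y =
      (1 / 4) * (1 - (if x = y then 1 else 0) - p x y * p x y) := by
  have hdiag : ∀ x, p x x = 0 := by
    intro x
    have := congrFun (congrFun hp x) x
    simp only [transpose_apply, neg_apply] at this
    linarith
  have h1 : (skewSymmetrize n (single x y 1)) x y = (1 / 2) * (1 - if x = y then 1 else 0) := by
    rw [skewSymmetrize_apply, transpose_single, smul_apply, sub_apply, single_apply_same,
      single_apply, smul_eq_mul]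
    by_cases h : x = y
    · simp [h]
    · simp [h, Ne.symm h]
  have h2 : (p * (skewSymmetrize n (single x y 1))ᴴ * p) x y = (1 / 2) * (p x y * p x y) := by
    rw [skewSymmetrize_apply, transpose_single, conjTranspose_smul, conjTranspose_sub,
      conjTranspose_single, conjTranspose_single, Matrix.mul_smul, Matrix.smul_mul,
      Matrix.mul_sub, Matrix.sub_mul, smul_apply, sub_apply, mul_single_mul_apply,
      mul_single_mul_apply, star_trivial, star_trivial, hdiag, hdiag]
    simp
  have h3 : (skewSymmetrize n - sandwich p ∘ₗ skewSymmetrize n) (single x y 1) x y =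
      (skewSymmetrize n (single x y 1)) x y -
        (p * (skewSymmetrize n (single x y 1))ᴴ * p) x y := rfl
  rw [entryTrace_smul, entryTrace_real, h3, h1, h2]
  ring

lemma blockJ_apply (v : Fin n → ℝ) (x y : Fin 2 × Fin n) :
    blockJ v x y = if x.2 = y.2 then v x.2 * !![0, -1; 1, 0] x.1 y.1 else 0 := by
  rw [blockJ, blockDiagonal_apply]
  rfl

lemma blockJ_transpose (v : Fin n → ℝ) : (blockJ v)ᵀ = -blockJ v := by
  ext ⟨a, i⟩ ⟨b, j⟩
  rw [transpose_apply, neg_apply, blockJ_apply, blockJ_apply]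
  by_cases h : i = j
  · subst h
    fin_cases a <;> fin_cases b <;> simp
  · simp [h, Ne.symm h]

lemma blockJ_mul (v w : Fin n → ℝ) :
    blockJ v * blockJ w = diagonal fun x : Fin 2 × Fin n => -(v x.2 * w x.2) := by
  rw [blockJ, blockJ, ← blockDiagonal_mul]
  ext ⟨a, i⟩ ⟨b, j⟩
  rw [blockDiagonal_apply, diagonal_apply]
  by_cases h : i = j
  · subst h
    fin_cases a <;> fin_cases b <;> simp [mul_apply]
  · simp [h]

lemma star_blockJ_mul (v w : Fin n → ℝ) :
    star (blockJ v) * blockJ w = diagonal fun x : Fin 2 × Fin n => v x.2 * w x.2 := by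
  rw [star_eq_conjTranspose, conjTranspose_eq_transpose_of_trivial, blockJ_transpose,
    Matrix.neg_mul, blockJ_mul]
  ext x y
  simp only [neg_apply, diagonal_apply]
  split_ifs <;> simp

lemma star_blockJ_signs_mul_self (I : Finset (Fin n)) :
    star (blockJ (signs I)) * blockJ (signs I) = 1 := by
  rw [star_blockJ_mul]
  simp only [signs_mul_self]
  exact diagonal_one

/-- A skew-symmetric orthogonal matrix that commutes with `a` also commutes with `a²`, hence
consists of skew-symmetric orthogonal `2 × 2` blocks. -/
lemma eq_blockJ_signs {lam : Fin n → ℝ} (hpos : ∀ i, 0 < lam i) (hmono : StrictMono lam)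
    {p : Matrix (Fin 2 × Fin n) (Fin 2 × Fin n) ℝ} (hskew : pᵀ = -p) (hp : star p * p = 1)
    (hc : star p * blockJ lam = star (blockJ lam) * p) :
    ∃ I : Finset (Fin n), p = blockJ (signs I) := by
  classical
  rw [star_eq_conjTranspose, star_eq_conjTranspose, conjTranspose_eq_transpose_of_trivial,
    conjTranspose_eq_transpose_of_trivial, hskew, blockJ_transpose, Matrix.neg_mul,
    Matrix.neg_mul, neg_inj] at hc
  have h2 : p * (blockJ lam * blockJ lam) = blockJ lam * blockJ lam * p := by
    rw [← Matrix.mul_assoc, hc, Matrix.mul_assoc, hc, Matrix.mul_assoc]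
  have hoff : ∀ x y : Fin 2 × Fin n, x.2 ≠ y.2 → p x y = 0 := by
    intro x y hxy
    have h3 := congrFun (congrFun h2 x) y
    rw [blockJ_mul, mul_diagonal, diagonal_mul] at h3
    have h4 : ((lam y.2 - lam x.2) * (lam y.2 + lam x.2)) * p x y = 0 := by linarith
    rcases mul_eq_zero.1 h4 with h5 | h5
    · refine absurd (hmono.injective ?_) hxy.symm
      have := hpos x.2
      have := hpos y.2
      rcases mul_eq_zero.1 h5 with h5 | h5 <;> linarith
    · exact h5
  have hsk : ∀ x y, p y x = -p x y := fun x y => congrFun (congrFun hskew x) y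
  have hdiag : ∀ x, p x x = 0 := fun x => by have := hsk x x; linarith
  have hsq : ∀ j, p (1, j) (0, j) = 1 ∨ p (1, j) (0, j) = -1 := by
    intro j
    have h3 := congrFun (congrFun hp (0, j)) (0, j)
    rw [mul_apply, Finset.sum_eq_single ((1 : Fin 2), j), star_apply, one_apply_eq, star_trivial]
      at h3
    · exact mul_self_eq_one_iff.1 h3
    · rintro ⟨b, i⟩ _ hb
      by_cases hij : i = j
      · subst hij
        fin_cases b
        · simp [hdiag]
        · simp at hb
      · rw [hoff _ _ hij, mul_zero]
    · simp
  refine ⟨Finset.univ.filter fun j => p (1, j) (0, j) = -1, ?_⟩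
  have hs : ∀ j, signs (Finset.univ.filter fun j => p (1, j) (0, j) = -1) j = p (1, j) (0, j) := by
    intro j
    rw [signs]
    rcases hsq j with h | h <;> norm_num [h]
  ext ⟨a, i⟩ ⟨b, j⟩
  rw [blockJ_apply]
  by_cases h : i = j
  · subst h
    rw [if_pos rfl, hs]
    fin_cases a <;> fin_cases b
    · simp [hdiag]
    · simp [hsk (1, i) (0, i)]
    · simp
    · simp [hdiag]
  · rw [if_neg h, hoff _ _ h]

theorem morse_complexStructureManifold {lam : Fin n → ℝ} (hpos : ∀ i, 0 < lam i)
    (hmono : StrictMono lam) :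
    IsMorseFunction (complexStructureManifold n) (distSq (blockJ lam)) ∧
      criticalSet (complexStructureManifold n) (distSq (blockJ lam)) =
        {x | ∃ I : Finset (Fin n), x = blockJ (signs I)} ∧
      ∀ I : Finset (Fin n),
        HasMorseIndex (complexStructureManifold n) (distSq (blockJ lam))
          (blockJ (signs I)) (2 * (indexSum I - I.card)) := by
  have hV : ∀ v : Fin n → ℝ, blockJ v ∈ (complexStructureSlice n).space := blockJ_transpose
  have hcar : ∀ I : Finset (Fin n), blockJ (signs I) ∈ (complexStructureSlice n).carrier :=
    fun I => ⟨hV _, trivial, star_blockJ_signs_mul_self I⟩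
  have hdim : ∀ p ∈ (complexStructureSlice n).carrier, ∑ x, ∑ y,
      entryTrace ((1 / 2 : ℝ) • (skewSymmetrize n - sandwich p ∘ₗ skewSymmetrize n)) x y =
        (1 / 4) * ((2 * n : ℝ) ^ 2 - 2 * n - 2 * n) := by
    rintro p ⟨hskew, -, hp⟩
    have hsq : ∑ x, ∑ y, p x y * p x y = 2 * n := by
      have h : (star p * p).trace = 2 * n := by
        rw [show star p * p = 1 from hp, trace_one]
        simp
      rw [Finset.sum_comm, ← h]
      simp [trace, mul_apply, star_apply]
    simp only [entryTrace_complexStructure hskew, ← Finset.mul_sum, Finset.sum_sub_distrib, hsq]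
    simp
    ring
  have := UnitarySlice.isMorseFunction_and_criticalSet (realTraceForm.matrix (Fin 2 × Fin n))
    (hV lam) (fun _ : Finset (Fin n) => True) (fun I => blockJ (signs I))
    (fun I => 2 * (indexSum I - I.card)) (finrank_tangent_eq isProj_skewSymmetrize hdim)
    (fun p hp hc => ?_) (fun I _ => ⟨hcar I, ?_⟩) (fun I _ d c => ?_)
  · rw [carrier_complexStructureSlice] at this
    simpa only [true_and, forall_const] using this
  · obtain ⟨I, hI⟩ := eq_blockJ_signs hpos hmono hp.1 hp.2.2 hc
    exact ⟨I, trivial, hI⟩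
  · refine (star_blockJ_mul _ _).trans (Eq.trans ?_ (star_blockJ_mul _ _).symm)
    simp only [mul_comm]
  · have h := nondegenerate_and_sigNeg realTraceForm hpos hmono Prod.snd I (star_blockJ_mul _ _)
      (fun h hh x y => by rw [← norm_neg, ← neg_apply, ← show hᵀ = -h from hh.1, transpose_apply])
      (UnitarySlice.isProj_tangent (hcar I) isProj_skewSymmetrize)
      (maskEntries_tangentProj I (fun x y hxy => by rw [blockJ_apply, if_neg hxy]) fun h => by
        rw [skewSymmetrize_apply, skewSymmetrize_apply, map_smul, map_sub, maskEntries_transpose])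
      c
    refine ⟨h.1, ?_⟩
    have h2 := h.2
    rw [trace_maskEntries_comp] at h2
    have e : ∀ x y : Fin 2 × Fin n, (if max x.2 y.2 ∈ I then entryTrace ((1 / 2 : ℝ) •
        (skewSymmetrize n - sandwich (blockJ (signs I)) ∘ₗ skewSymmetrize n)) x y else 0) =
        (1 / 4) * (if max x.2 y.2 ∈ I then 1 else 0) -
          (1 / 4) * (if max x.2 y.2 ∈ I then (if x.2 = y.2 then 1 else 0) else 0) := by
      rintro ⟨a, i⟩ ⟨b, j⟩
      rw [entryTrace_complexStructure (blockJ_transpose _), blockJ_apply]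
      by_cases hij : i = j
      · subst hij
        have := signs_mul_self I i
        fin_cases a <;> fin_cases b <;> simp [this]
      · simp [hij]
    simp only [e, Fintype.sum_prod_type, Fin.sum_univ_two, Finset.sum_sub_distrib,
      Finset.sum_add_distrib, ← Finset.mul_sum, sum_max_mem, sum_max_mem_eq] at h2
    have h3 : (sigNeg (hessian (distSq (blockJ lam)) c).toQuadraticMap : ℝ) =
        ((2 * (indexSum I - I.card) : ℤ) : ℝ) := by
      rw [h2]; push_cast; ring
    exact_mod_cast h3

end ComplexStructures

end Matrix

/-! ### The distance functions on the matrix manifolds -/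

theorem theorem3 (n : ℕ) (lam : Fin n → ℝ) (hpos : ∀ i, 0 < lam i) (hmono : StrictMono lam) :
    -- O(n; ℝ)
    (IsMorseFunction (orthogonalManifold n ℝ) (distSq (realDiagonal ℝ lam)) ∧
      criticalSet (orthogonalManifold n ℝ) (distSq (realDiagonal ℝ lam)) =
        {x | ∃ I : Finset (Fin n), x = realDiagonal ℝ (signs I)} ∧
      ∀ I : Finset (Fin n),
        HasMorseIndex (orthogonalManifold n ℝ) (distSq (realDiagonal ℝ lam))
          (realDiagonal ℝ (signs I)) (Module.finrank ℝ ℝ * indexSum I - I.card)) ∧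
    -- O(n; ℂ)
    (IsMorseFunction (orthogonalManifold n ℂ) (distSq (realDiagonal ℂ lam)) ∧
      criticalSet (orthogonalManifold n ℂ) (distSq (realDiagonal ℂ lam)) =
        {x | ∃ I : Finset (Fin n), x = realDiagonal ℂ (signs I)} ∧
      ∀ I : Finset (Fin n),
        HasMorseIndex (orthogonalManifold n ℂ) (distSq (realDiagonal ℂ lam))
          (realDiagonal ℂ (signs I)) (Module.finrank ℝ ℂ * indexSum I - I.card)) ∧
    -- O(n; ℍ)
    (IsMorseFunction (orthogonalManifold n (Quaternion ℝ))
        (distSq (realDiagonal (Quaternion ℝ) lam)) ∧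
      criticalSet (orthogonalManifold n (Quaternion ℝ))
          (distSq (realDiagonal (Quaternion ℝ) lam)) =
        {x | ∃ I : Finset (Fin n), x = realDiagonal (Quaternion ℝ) (signs I)} ∧
      ∀ I : Finset (Fin n),
        HasMorseIndex (orthogonalManifold n (Quaternion ℝ))
          (distSq (realDiagonal (Quaternion ℝ) lam)) (realDiagonal (Quaternion ℝ) (signs I))
          (Module.finrank ℝ (Quaternion ℝ) * indexSum I - I.card)) ∧
    -- the Grassmannians
    (∀ k : ℕ,
      IsMorseFunction (grassmannManifold n k) (distSq (realDiagonal ℂ lam)) ∧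
      criticalSet (grassmannManifold n k) (distSq (realDiagonal ℂ lam)) =
        {x | ∃ I : Finset (Fin n), I.card = k ∧ x = realDiagonal ℂ (signs I)} ∧
      ∀ (I : Finset (Fin n)) (hI : I.card = k),
        HasMorseIndex (grassmannManifold n k) (distSq (realDiagonal ℂ lam))
          (realDiagonal ℂ (signs I))
          (2 * ∑ s : Fin k, (((I.orderEmbOfFin hI s : ℕ) + 1 : ℤ) - ((s : ℕ) + 1 : ℤ)))) ∧
    -- the Lagrangian Grassmannian
    (IsMorseFunction (lagrangianManifold n) (distSq (realDiagonal ℂ lam)) ∧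
      criticalSet (lagrangianManifold n) (distSq (realDiagonal ℂ lam)) =
        {x | ∃ I : Finset (Fin n), x = realDiagonal ℂ (signs I)} ∧
      ∀ I : Finset (Fin n),
        HasMorseIndex (lagrangianManifold n) (distSq (realDiagonal ℂ lam))
          (realDiagonal ℂ (signs I)) (indexSum I)) ∧
    -- the space of complex structures
    (IsMorseFunction (complexStructureManifold n) (distSq (blockJ lam)) ∧
      criticalSet (complexStructureManifold n) (distSq (blockJ lam)) =
        {x | ∃ I : Finset (Fin n), x = blockJ (signs I)} ∧
      ∀ I : Finset (Fin n),
        HasMorseIndex (complexStructureManifold n) (distSq (blockJ lam))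
          (blockJ (signs I)) (2 * (indexSum I - I.card))) := by
  refine ⟨?_, ?_, ?_, fun k => Matrix.morse_grassmannManifold hpos hmono k,
    Matrix.morse_lagrangianManifold hpos hmono, Matrix.morse_complexStructureManifold hpos hmono⟩
  · exact Matrix.morse_orthogonalManifold Matrix.realTraceForm rfl
      (fun z => by simp [Matrix.realTraceForm]; ring) hpos hmono
  · exact Matrix.morse_orthogonalManifold Matrix.complexTraceForm
      (by simp [Matrix.complexTraceForm])
      (fun z => by apply Complex.ext <;> simp [Matrix.complexTraceForm]; ring) hpos hmono
  · have : StarModule ℝ (Quaternion ℝ) := ⟨fun r x => by ext <;> simp⟩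
    refine Matrix.morse_orthogonalManifold Matrix.quaternionTraceForm Quaternion.re_one
      (fun z => ?_) hpos hmono
    change star z = (2 * z.re) • (1 : Quaternion ℝ) - z
    rw [Quaternion.star_eq_two_re_sub, Algebra.smul_def, mul_one]
    rfl
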